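/- Let $\Gamma$ be a finite connected regular graph of valence $q+1\ge 2$ ($q$ a positive integer) with vertex set $V(\Gamma)$, $|\Gamma|=\#V(\Gamma)$, without multiple edges and without edges joining a vertex to itself. Let $T$ be its averaging (adjacency) operator on $\mathbb{C}^{V(\Gamma)}$, $(Tf)(v)=\sum_{v'\sim v}f(v')$, with eigenvalues $\lambda_1,\dots,\lambda_{|\Gamma|}$ listed with multiplicity, and let $\rho(s)=\sum_{j=1}^{|\Gamma|}\delta(s-\lambda_j)$. A closed trajectory of length $n\geq 1$ is a cyclic sequence of vertices $(v_1,\dots,v_n)$, up to cyclic permutation, with $v_i$ adjacent to $v_{i+1}$ for all $i$ (indices modulo $n$). Let $G$ be the set of long geodesics, i.e. closed trajectories $\gamma$ of length $|\gamma|\ge 1$ with $v_i\ne v_{i+2}$ for all $i$ (indices modulo $|\gamma|$). A trajectory is primitive if it is not the $r$-th power (the trajectory walked around $r$ times) of a trajectory for any $r\neq 1$; for $\gamma=(\gamma')^r$ with $\gamma'$ primitive put $\Lambda(\gamma)=|\gamma'|$. Let $T_l$ be the Chebyshev polynomial of the first kind of degree $l$, and let $\theta$ be the unit step function. Then, as generalized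 functions, $$\rho(s)=|\Gamma|\,\frac{q+1}{2\pi}\,\frac{\sqrt{4q-s^2}}{(q+1)^2-s^2}\,\theta(4q-s^2)+\sum_{\gamma\in G}\Lambda(\gamma)\,q^{-|\gamma|/2}\,\frac{T_{|\gamma|}\!\left(\frac{s}{2\sqrt q}\right)}{\pi\sqrt{4q-s^2}}\,\theta(4q-s^2).$$ Here generalized functions are tested against functions $\varphi$ holomorphic in a neighbourhood of the closed region $\{z\in\mathbb{C}: |z-2\sqrt q|+|z+2\sqrt q|\le 2(q+1)\}$ (in particular against all entire functions). Explicitly: for each such $\varphi$, the product of $\varphi$ with each term on the right is integrable over $\mathbb{R}$, the series over $G$ of the resulting integrals converges absolutely, and $\sum_j\varphi(\lambda_j)$ equals the integral of $\varphi$ against the first term plus the sum of that series. -/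

import Mathlib

open MeasureTheory

noncomputable section

namespace RegularGraphTrace

section Operator

variable {V : Type*} [Fintype V] (G : SimpleGraph V) [DecidableRel G.Adj]

/-- The averaging (adjacency) operator: `(T f)(v)` is the sum of `f` over the neighbours of `v`. -/
def averagingOperator : (V → ℂ) →ₗ[ℂ] (V → ℂ) where
  toFun f v := ∑ w ∈ G.neighborFinset v, f w
  map_add' f g := by
    funext v
    simp [Finset.sum_add_distrib]
  map_smul' c f := by
    funext v
    simp [Finset.mul_sum]

/-- The spectral density `∑ⱼ δ(s - λⱼ)` as a functional on test functions: it sends `φ` to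
`∑ⱼ φ(λⱼ)`, where the `λⱼ` are the eigenvalues of the averaging operator, listed with
multiplicity. -/
def spectralDensity (φ : ℂ → ℂ) : ℂ :=
  ((averagingOperator G).charpoly.roots.map φ).sum

end Operator

section Geodesics

variable {V : Type*} (G : SimpleGraph V)

/-- A closed trajectory: a closed path `(v₁, …, vₙ)` with each `vᵢ` adjacent to `vᵢ₊₁` (indices
modulo `n`), up to cyclic permutation. The empty cycle is the only one of length `0`; it plays no
role, since only trajectories of positive length are used below. -/
def Trajectory : Type _ := {c : Cycle V // c.Chain G.Adj}

variable {G}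

namespace Trajectory

/-- The number of steps of a closed trajectory. -/
def length (γ : Trajectory G) : ℕ := γ.1.length

/-- `γ` is the `r`-th power of `δ`: it is `δ` walked around `r` times. -/
def IsPower (δ : Trajectory G) (r : ℕ) (γ : Trajectory G) : Prop :=
  ∃ p : List V, (p : Cycle V) = δ.1 ∧ ((List.replicate r p).flatten : Cycle V) = γ.1

/-- A trajectory is primitive if it is not a non-unit power of any trajectory. -/
def IsPrimitive (γ : Trajectory G) : Prop :=
  ∀ (δ : Trajectory G) (r : ℕ), IsPower δ r γ → r = 1

/-- A long geodesic: a closed trajectory of positive length such that `vᵢ ≠ vᵢ₊₂` for all `i`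
(indices modulo the length). -/
def IsLongGeodesic (γ : Trajectory G) : Prop :=
  0 < γ.length ∧ ∀ p : List V, (p : Cycle V) = γ.1 →
    ∀ i : Fin p.length, p.get i ≠ p.get ⟨(i + 2) % p.length, Nat.mod_lt _ i.pos⟩

/-- `Λ(γ)`: the length of the primitive trajectory of which `γ` is a power. (All primitive
trajectories that have `γ` as a power have the same length, so the infimum is over a singleton when
`γ` has positive length.) -/
def primitiveLength (γ : Trajectory G) : ℕ :=
  sInf {n : ℕ | ∃ (δ : Trajectory G) (r : ℕ), δ.IsPrimitive ∧ IsPower δ r γ ∧ δ.length = n}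

end Trajectory

variable (G)

/-- The set of long closed geodesics of the graph. -/
def LongGeodesic : Type _ := {γ : Trajectory G // γ.IsLongGeodesic}

end Geodesics

/-- The unit step function. -/
def unitStep (x : ℝ) : ℝ := if 0 ≤ x then 1 else 0

/-- The contribution of contractible closed paths, for a graph with `n` vertices, of valence
`q + 1`. -/
def contractibleDensity (n q : ℕ) (s : ℝ) : ℝ :=
  n * (((q : ℝ) + 1) / (2 * Real.pi)) *
    (Real.sqrt (4 * q - s ^ 2) / (((q : ℝ) + 1) ^ 2 - s ^ 2)) * unitStep (4 * q - s ^ 2)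

/-- The contribution of a long geodesic `γ`, on a graph of valence `q + 1`. -/
def geodesicDensity {V : Type*} {G : SimpleGraph V} (q : ℕ) (γ : LongGeodesic G) (s : ℝ) : ℝ :=
  (γ.1.primitiveLength : ℝ) * (q : ℝ) ^ (-(γ.1.length : ℝ) / 2) *
    ((Polynomial.Chebyshev.T ℝ (γ.1.length : ℤ)).eval (s / (2 * Real.sqrt q)) /
      (Real.pi * Real.sqrt (4 * q - s ^ 2))) * unitStep (4 * q - s ^ 2)

/-- The closed region bounded by the ellipse with foci `±2√q` through `±(q + 1)` (for `q = 1`, the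
segment `[-2, 2]`). -/
def ellipticRegion (q : ℕ) : Set ℂ :=
  {z : ℂ | ‖z - ((2 * Real.sqrt q : ℝ) : ℂ)‖ + ‖z + ((2 * Real.sqrt q : ℝ) : ℂ)‖ ≤
    2 * ((q : ℝ) + 1)}

/-- Test functions: functions holomorphic in a neighbourhood of the elliptic region; all entire
functions are among them. Generalized functions are functionals on these. -/
def IsTestFunction (q : ℕ) (φ : ℂ → ℂ) : Prop := AnalyticOnNhd ℂ φ (ellipticRegion q)

/-- The value `∫ f(s) φ(s) ds` of an ordinary function `f` on `ℝ`, seen as a generalized function,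
at the test function `φ`. -/
def pairing (f : ℝ → ℝ) (φ : ℂ → ℂ) : ℂ := ∫ s : ℝ, (f s : ℂ) * φ (s : ℂ)

end RegularGraphTrace

end

/-! Both sides are compared through the numbers $N_n$ of based closed walks of length $n\ge1$ with
$v_i\ne v_{i+2}$ cyclically. A long geodesic $\gamma$ has exactly $\Lambda(\gamma)$ base points
giving distinct walks, so $\sum_\gamma\Lambda(\gamma)h(|\gamma|)=\sum_n N_n h(n)$
(`hasSum_longGeodesic`).

On oriented edges, $N_n=\operatorname{tr}B^n$ for Hashimoto's matrix $B$ (`loopCount_succ`), and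
$\operatorname{tr}B^n=\operatorname{tr}D_n(A)+\frac{q-1}2(1+(-1)^n)|\Gamma|$
(`trace_edgeMatrix_pow`). Here $A$ is the adjacency matrix and $D_n$ the Dickson polynomial with
$D_n(a+b)=a^n+b^n$ whenever $ab=q$. Writing an eigenvalue as $\lambda=\sqrt q(w+w^{-1})$ gives
$q^{-n/2}D_n(\lambda)=w^n+w^{-n}$.

The substitution $s=2\sqrt q\cos\theta$ turns the pairing of $\varphi$ with the $\gamma$ term into
$\Lambda(\gamma)q^{-n/2}c_n$, where $n=|\gamma|$ and $c_n=\frac1\pi\int_0^\pi\varphi(2\sqrt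
q\cos\theta)\cos n\theta\,d\theta$. Two sums remain. The Chebyshev expansion
$\sum_{n\ge0}(w^n+w^{-n})c_n=\varphi(\lambda)+c_0$ (`IsTestFunction.hasSum_cosCoeff`) holds because
$|\lambda|\le q+1$ puts $\lambda$ in the ellipse. The parity term is a geometric series, which sums
to $qc_0$ minus the contractible pairing per vertex (`hasSum_parity_cosCoeff`). Once the $n=0$ terms
are removed, all multiples of $c_0$ cancel. -/

namespace RegularGraphTrace

/-! ### Rotations, powers and periods of cyclic words -/

section CyclicLists

variable {α : Type*}

theorem length_flatten_replicate (r : ℕ) (p : List α) :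
    (List.replicate r p).flatten.length = r * p.length := by
  simp

theorem getElem_flatten_replicate (r : ℕ) (p : List α) (i : ℕ)
    (hi : i < (List.replicate r p).flatten.length) (hi' : i % p.length < p.length) :
    (List.replicate r p).flatten[i] = p[i % p.length] := by
  induction r generalizing i with
  | zero => simp at hi
  | succ r ih =>
    simp only [List.replicate_succ, List.flatten_cons, List.getElem_append]
    split_ifs with h
    · simp [Nat.mod_eq_of_lt h]
    · have h1 : (i - p.length) % p.length = i % p.length := (Nat.mod_eq_sub_mod (not_lt.1 h)).symm
      rw [ih (i - p.length) _ (by rw [h1]; exact hi')]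
      simp [h1]

theorem flatten_replicate_rotate (r : ℕ) (p : List α) (k : ℕ) :
    (List.replicate r p).flatten.rotate k = (List.replicate r (p.rotate k)).flatten := by
  refine List.ext_getElem (by simp) fun i h1 h2 => ?_
  have hp : 0 < p.length := by
    rcases Nat.eq_zero_or_pos p.length with h | h
    · simp [h] at h1
    · exact h
  rw [List.getElem_rotate, getElem_flatten_replicate _ _ _ _ (Nat.mod_lt _ hp),
    getElem_flatten_replicate _ _ _ _ (by simpa using Nat.mod_lt _ hp), List.getElem_rotate]
  simp

theorem flatten_replicate_injective {r : ℕ} (hr : 0 < r) :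
    Function.Injective fun p : List α => (List.replicate r p).flatten := by
  intro p p' h
  simp only at h
  have hl : p.length = p'.length := by
    have := congrArg List.length h
    rw [length_flatten_replicate, length_flatten_replicate] at this
    exact Nat.eq_of_mul_eq_mul_left hr this
  refine List.ext_getElem hl fun i h1 h2 => ?_
  have e1 := getElem_flatten_replicate r p i
    (by rw [length_flatten_replicate]; nlinarith) (Nat.mod_lt _ (by omega))
  have e2 := getElem_flatten_replicate r p' i
    (by rw [length_flatten_replicate]; nlinarith) (Nat.mod_lt _ (by omega))
  simp only [Nat.mod_eq_of_lt h1, Nat.mod_eq_of_lt h2] at e1 e2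
  rw [← e1, ← e2]
  simp [h]

/-- The least positive rotation fixing a list. -/
noncomputable def rotationPeriod (l : List α) : ℕ :=
  Function.minimalPeriod (fun l : List α => l.rotate 1) l

theorem rotate_one_iterate (k : ℕ) (l : List α) :
    (fun l : List α => l.rotate 1)^[k] l = l.rotate k := by
  induction k with
  | zero => simp
  | succ k ih => rw [Function.iterate_succ_apply', ih, List.rotate_rotate]

theorem isPeriodicPt_rotate_iff (k : ℕ) (l : List α) :
    Function.IsPeriodicPt (fun l : List α => l.rotate 1) k l ↔ l.rotate k = l := by
  rw [Function.IsPeriodicPt, Function.IsFixedPt, rotate_one_iterate]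

theorem rotationPeriod_dvd_length (l : List α) : rotationPeriod l ∣ l.length :=
  Function.IsPeriodicPt.minimalPeriod_dvd ((isPeriodicPt_rotate_iff _ _).2 (List.rotate_length l))

theorem rotate_rotationPeriod (l : List α) : l.rotate (rotationPeriod l) = l :=
  (isPeriodicPt_rotate_iff _ _).1 (Function.isPeriodicPt_minimalPeriod _ _)

theorem rotationPeriod_pos {l : List α} (hl : 0 < l.length) : 0 < rotationPeriod l :=
  Nat.pos_of_dvd_of_pos (rotationPeriod_dvd_length l) hl

/-- Rotation commutes with taking the $r$-th power, and the power map is injective, so a word and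
its power are fixed by the same rotations. -/
theorem rotationPeriod_flatten_replicate {r : ℕ} (hr : 0 < r) (p : List α) :
    rotationPeriod (List.replicate r p).flatten = rotationPeriod p := by
  refine Function.minimalPeriod_eq_minimalPeriod_iff.2 fun n => ?_
  rw [isPeriodicPt_rotate_iff, isPeriodicPt_rotate_iff, flatten_replicate_rotate]
  exact (flatten_replicate_injective hr).eq_iff

theorem rotationPeriod_rotate (l : List α) (k : ℕ) :
    rotationPeriod (l.rotate k) = rotationPeriod l := by
  refine Function.minimalPeriod_eq_minimalPeriod_iff.2 fun n => ?_
  rw [isPeriodicPt_rotate_iff, isPeriodicPt_rotate_iff, List.rotate_rotate, add_comm,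
    ← List.rotate_rotate]
  exact (List.rotate_injective k).eq_iff

theorem rotationPeriod_congr {l l' : List α} (h : (l : Cycle α) = l') :
    rotationPeriod l = rotationPeriod l' := by
  obtain ⟨k, rfl⟩ := Cycle.coe_eq_coe.1 h
  rw [rotationPeriod_rotate]

/-- Invariance under rotation by all multiples of the period makes each entry depend only on its
index modulo the period. -/
theorem eq_flatten_replicate_take (l : List α) :
    (List.replicate (l.length / rotationPeriod l) (l.take (rotationPeriod l))).flatten = l := by
  rcases Nat.eq_zero_or_pos l.length with h0 | hl
  · rw [List.eq_nil_of_length_eq_zero h0]; simp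
  set d := rotationPeriod l with hd
  have hdvd : d ∣ l.length := rotationPeriod_dvd_length l
  have hdpos : 0 < d := rotationPeriod_pos hl
  have htl : (l.take d).length = d := by
    rw [List.length_take]; exact min_eq_left (Nat.le_of_dvd hl hdvd)
  refine List.ext_getElem ?_ fun i h1 h2 => ?_
  · rw [length_flatten_replicate, htl, Nat.div_mul_cancel hdvd]
  rw [getElem_flatten_replicate _ _ _ _ (Nat.mod_lt _ (by omega)), List.getElem_take]
  have hrot : ∀ j, l.rotate (d * j) = l := by
    intro j
    induction j with
    | zero => simp
    | succ j ih => rw [Nat.mul_succ, ← List.rotate_rotate, ih, hd, rotate_rotationPeriod]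
  have h3 : i % d < l.length := (Nat.mod_le _ _).trans_lt h2
  have := List.getElem_rotate l (d * (i / d)) (i % d) (by simpa using h3)
  simp only [hrot, Nat.mod_add_div, Nat.mod_eq_of_lt h2] at this
  simp only [htl, this]

theorem finite_coe_eq (l : List α) : {p : List α | (p : Cycle α) = l}.Finite := by
  refine (List.finite_toSet l.cyclicPermutations).subset fun p hp => ?_
  exact List.mem_cyclicPermutations_iff.2 (Cycle.coe_eq_coe.1 hp)

/-- The representatives of a cycle form one rotation orbit, whose size is the minimal period. This
is the source of the weight $\Lambda$. -/
theorem ncard_coe_eq {l : List α} (hl : 0 < l.length) :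
    {p : List α | (p : Cycle α) = l}.ncard = rotationPeriod l := by
  have : {p : List α | (p : Cycle α) = l} =
      (fun k => l.rotate k) '' Set.Iio (rotationPeriod l) := by
    ext p
    simp only [Set.mem_ofPred_eq, Set.mem_image, Set.mem_Iio]
    constructor
    · intro h
      obtain ⟨k, rfl⟩ := Cycle.coe_eq_coe.1 h.symm
      refine ⟨k % rotationPeriod l, Nat.mod_lt _ (rotationPeriod_pos hl), ?_⟩
      rw [← rotate_one_iterate, ← rotate_one_iterate]
      exact Function.iterate_mod_minimalPeriod_eq
    · rintro ⟨k, -, rfl⟩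
      exact Cycle.coe_eq_coe.2 (List.IsRotated.forall l k)
  rw [this, Set.InjOn.ncard_image, Set.ncard_Iio_nat]
  have := Function.iterate_injOn_Iio_minimalPeriod (f := fun l : List α => l.rotate 1) (x := l)
  intro a ha b hb hab
  exact this ha hb (by simpa only [rotate_one_iterate] using hab)

theorem chain_coe_iff (R : α → α → Prop) (p : List α) :
    (p : Cycle α).Chain R ↔ ∀ i (hi : i < p.length),
      R p[i] (p[(i + 1) % p.length]'(Nat.mod_lt _ (by omega))) := by
  cases p with
  | nil => simp
  | cons a l =>
    rw [Cycle.chain_coe_cons, List.isChain_iff_getElem]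
    simp only [← List.cons_append, List.length_append, List.length_cons, List.length_nil, zero_add]
    refine forall_congr' fun i => ?_
    have key : ∀ hi : i < l.length + 1,
        ((a :: l ++ [a])[i + 1]'(by simp; omega)) = 
          (a :: l)[(i + 1) % (l.length + 1)]'(Nat.mod_lt _ (by simp)) := by
      intro hi
      rw [List.getElem_append]
      split_ifs with h
      · simp only [List.length_cons] at h
        simp [Nat.mod_eq_of_lt h]
      · simp only [List.length_cons] at h
        have : i = l.length := by omega
        subst this
        simp
    constructor
    · intro h hi
      have := h (by omega)
      rw [key hi, List.getElem_append_left (by simpa using hi)] at this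
      exact this
    · intro h hi
      rw [key (by omega), List.getElem_append_left (by simp; omega)]
      exact h (by omega)

end CyclicLists
-- Regrouping sums along maps with finite fibres
section FiberSums

theorem summable_comp_of_finite_fibers {ι κ : Type*} (f : ι → κ) (hf : ∀ k, Finite {i // f i = k})
    (g : κ → ℂ) (hg : Summable fun k => (Nat.card {i // f i = k} : ℝ) * ‖g k‖) :
    Summable fun i => g (f i) := by
  refine Summable.of_norm ?_
  rw [← (Equiv.sigmaFiberEquiv f).summable_iff]
  refine (summable_sigma_of_nonneg fun _ => norm_nonneg _).2
    ⟨fun k => Summable.of_finite, hg.congr fun k => ?_⟩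
  rw [tsum_congr (g := fun _ => ‖g k‖) (fun c => by simp [c.2]), tsum_const, nsmul_eq_mul]

theorem hasSum_of_hasSum_comp {ι κ : Type*} (f : ι → κ) (hf : ∀ k, Finite {i // f i = k})
    (g : κ → ℂ) {a : ℂ} (hg : HasSum (fun i => g (f i)) a) :
    HasSum (fun k => (Nat.card {i // f i = k} : ℂ) * g k) a := by
  rw [← (Equiv.sigmaFiberEquiv f).hasSum_iff] at hg
  refine hg.sigma fun k => ?_
  have := (Summable.of_finite (f := fun _ : {i // f i = k} => g k)
    (L := SummationFilter.unconditional _)).hasSum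
  rw [tsum_const, nsmul_eq_mul] at this
  convert this using 2 with c
  simp [c.2]

end FiberSums

/-! ### Long geodesics versus based reduced loops -/

section Trajectories

variable {V : Type*} {G : SimpleGraph V}

/-- The condition `vᵢ ≠ vᵢ₊₂` on the entries of a list, with indices modulo its length. -/
def CyclicallyReduced (p : List V) : Prop :=
  ∀ i (hi : i < p.length), p[i] ≠ p[(i + 2) % p.length]'(Nat.mod_lt _ (by omega))

theorem CyclicallyReduced.rotate {p : List V} (h : CyclicallyReduced p) (k : ℕ) :
    CyclicallyReduced (p.rotate k) := by
  intro i hi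
  have hp : 0 < p.length := by simp only [List.length_rotate] at hi; omega
  have := h ((i + k) % p.length) (Nat.mod_lt _ hp)
  rw [List.getElem_rotate, List.getElem_rotate]
  have e : ((i + k) % p.length + 2) % p.length =
      ((i + 2) % (p.rotate k).length + k) % p.length := by
    rw [List.length_rotate, Nat.mod_add_mod, Nat.mod_add_mod]
    congr 1; omega
  simpa only [e] using this

namespace Trajectory

theorem isLongGeodesic_iff {γ : Trajectory G} {l : List V} (hl : (l : Cycle V) = γ.1) :
    γ.IsLongGeodesic ↔ 0 < l.length ∧ CyclicallyReduced l := by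
  have hlen : γ.length = l.length := by rw [Trajectory.length, ← hl, Cycle.length_coe]
  rw [IsLongGeodesic, hlen]
  refine and_congr_right fun hpos => ⟨fun h i hi => h l hl ⟨i, hi⟩, fun h p hp i => ?_⟩
  obtain ⟨k, rfl⟩ := Cycle.coe_eq_coe.1 (hl.trans hp.symm)
  exact h.rotate k i i.2

theorem IsPower.rotationPeriod_eq {γ δ : Trajectory G} {r : ℕ} (h : IsPower δ r γ) {l m : List V}
    (hl : (l : Cycle V) = γ.1) (hm : (m : Cycle V) = δ.1) (hpos : 0 < l.length) :
    rotationPeriod m = rotationPeriod l ∧ l.length = r * m.length := by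
  obtain ⟨p, hp, hr⟩ := h
  have hlen : l.length = r * p.length := by
    rw [← length_flatten_replicate, ← Cycle.length_coe, ← Cycle.length_coe, hl, hr]
  have hr0 : 0 < r := by
    rcases Nat.eq_zero_or_pos r with h0 | h0
    · simp [h0] at hlen; simp [hlen] at hpos
    · exact h0
  have hmp : m.length = p.length := by rw [← Cycle.length_coe, ← Cycle.length_coe, hm, hp]
  refine ⟨?_, by rw [hlen, hmp]⟩
  rw [rotationPeriod_congr (hl.trans hr.symm), rotationPeriod_flatten_replicate hr0,
    rotationPeriod_congr (hm.trans hp.symm)]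

theorem exists_isPower {γ : Trajectory G} {l : List V} (hl : (l : Cycle V) = γ.1)
    (hpos : 0 < l.length) : ∃ (δ : Trajectory G) (r : ℕ), IsPower δ r γ ∧
      (l.take (rotationPeriod l) : Cycle V) = δ.1 := by
  have hd := rotationPeriod_dvd_length l
  have hd0 := rotationPeriod_pos hpos
  have htl : (l.take (rotationPeriod l)).length = rotationPeriod l := by
    rw [List.length_take]; exact min_eq_left (Nat.le_of_dvd hpos hd)
  have hch : ((l.take (rotationPeriod l) : List V) : Cycle V).Chain G.Adj := by
    have h := γ.2
    rw [← hl, chain_coe_iff] at h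
    rw [chain_coe_iff]
    intro i hi
    have hi' : i < l.length := by
      rw [htl] at hi; exact hi.trans_le (Nat.le_of_dvd hpos hd)
    have h1 := h i hi'
    have key : ∀ j (hj : j < l.length),
        l[j] = (l.take (rotationPeriod l))[j % (l.take (rotationPeriod l)).length]'(
          Nat.mod_lt _ (by omega)) := by
      intro j hj
      have := getElem_flatten_replicate (l.length / rotationPeriod l) (l.take (rotationPeriod l)) j
        (by rw [eq_flatten_replicate_take]; exact hj) (Nat.mod_lt _ (by omega))
      rw [← this]
      simp only [eq_flatten_replicate_take]
    rw [key i hi', key _ (Nat.mod_lt _ hpos)] at h1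
    have e1 : i % (l.take (rotationPeriod l)).length = i := Nat.mod_eq_of_lt hi
    have e2 : (i + 1) % l.length % (l.take (rotationPeriod l)).length =
        (i + 1) % (l.take (rotationPeriod l)).length := by
      rw [htl]; exact Nat.mod_mod_of_dvd _ hd
    simpa only [e1, e2] using h1
  exact ⟨⟨_, hch⟩, l.length / rotationPeriod l,
    ⟨_, rfl, by rw [eq_flatten_replicate_take, hl]⟩, rfl⟩

/-- Every word is a power of its initial block of period length. Conversely an $r$-th power of $p$
has period at most $|p|$, which is shorter than the word when $r\ge2$. -/
theorem isPrimitive_iff {γ : Trajectory G} {l : List V} (hl : (l : Cycle V) = γ.1)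
    (hpos : 0 < l.length) : γ.IsPrimitive ↔ rotationPeriod l = l.length := by
  constructor
  · intro h
    obtain ⟨δ, r, hp, hδ⟩ := exists_isPower hl hpos
    obtain rfl := h δ r hp
    have := (hp.rotationPeriod_eq hl hδ hpos).2
    rw [one_mul, List.length_take] at this
    have := Nat.le_of_dvd hpos (rotationPeriod_dvd_length l)
    omega
  · intro h δ r hp
    obtain ⟨p, hp1, hp2⟩ := id hp
    obtain ⟨h1, h2⟩ := hp.rotationPeriod_eq hl hp1 hpos
    have hp0 : 0 < p.length := by
      rcases Nat.eq_zero_or_pos p.length with h0 | h0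
      · simp [h0] at h2; simp [h2] at hpos
      · exact h0
    have := Nat.le_of_dvd hp0 (rotationPeriod_dvd_length p)
    have hr0 : r ≠ 0 := by rintro rfl; omega
    by_contra hr1
    have : 2 ≤ r := by omega
    nlinarith

/-- A root has the same period as its powers, and the period of a primitive root is its length. The
set under the infimum is therefore a singleton. -/
theorem primitiveLength_eq {γ : Trajectory G} {l : List V} (hl : (l : Cycle V) = γ.1)
    (hpos : 0 < l.length) : γ.primitiveLength = rotationPeriod l := by
  have : {n : ℕ | ∃ (δ : Trajectory G) (r : ℕ), δ.IsPrimitive ∧ IsPower δ r γ ∧ δ.length = n} =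
      {rotationPeriod l} := by
    ext n
    simp only [Set.mem_ofPred_eq, Set.mem_singleton_iff]
    constructor
    · rintro ⟨δ, r, hprim, hpow, rfl⟩
      obtain ⟨p, hp1, hp2⟩ := id hpow
      obtain ⟨h1, h2⟩ := hpow.rotationPeriod_eq hl hp1 hpos
      have hp0 : 0 < p.length := by
        rcases Nat.eq_zero_or_pos p.length with h0 | h0
        · simp [h0] at h2; simp [h2] at hpos
        · exact h0
      rw [← h1, (isPrimitive_iff hp1 hp0).1 hprim, Trajectory.length, ← hp1, Cycle.length_coe]
    · rintro rfl
      obtain ⟨δ, r, hp, hδ⟩ := exists_isPower hl hpos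
      have htl : (l.take (rotationPeriod l)).length = rotationPeriod l := by
        rw [List.length_take]
        exact min_eq_left (Nat.le_of_dvd hpos (rotationPeriod_dvd_length l))
      have hd0 := rotationPeriod_pos hpos
      refine ⟨δ, r, (isPrimitive_iff hδ (by omega)).2 ?_, hp, ?_⟩
      · rw [(hp.rotationPeriod_eq hl hδ hpos).1, htl]
      · rw [Trajectory.length, ← hδ, Cycle.length_coe, htl]
  rw [primitiveLength, this, csInf_singleton]

end Trajectory

variable (G) in
/-- The based closed walks without backtracking and without tail, as lists of vertices. -/
def ReducedLoop : Type _ :=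
  {p : List V // (p : Cycle V).Chain G.Adj ∧ 0 < p.length ∧ CyclicallyReduced p}

/-- The long geodesic underlying a based loop. -/
def ReducedLoop.toLongGeodesic (p : ReducedLoop G) : LongGeodesic G :=
  ⟨⟨p.1, p.2.1⟩, (Trajectory.isLongGeodesic_iff rfl).2 p.2.2⟩

variable (G) in
/-- The number of based loops of length `n`. -/
noncomputable def loopCount (n : ℕ) : ℕ := Nat.card {p : ReducedLoop G // p.1.length = n}

theorem ReducedLoop.finite_length_eq [Finite V] (n : ℕ) :
    Finite {p : ReducedLoop G // p.1.length = n} := by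
  have : Finite {p : List V // p.length = n} := (List.finite_length_eq V n).to_subtype
  refine Finite.of_injective (β := {p : List V // p.length = n}) (fun p => ⟨p.1.1, p.2⟩) ?_
  intro p q h
  exact Subtype.ext (Subtype.ext (Subtype.mk.inj h))

theorem LongGeodesic.finite_fiber_and_card (γ : LongGeodesic G) :
    Finite {p : ReducedLoop G // p.toLongGeodesic = γ} ∧
      Nat.card {p : ReducedLoop G // p.toLongGeodesic = γ} = γ.1.primitiveLength := by
  obtain ⟨l, hl⟩ := Quotient.exists_rep γ.1.1
  have hl : (l : Cycle V) = γ.1.1 := hl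
  have hg := (Trajectory.isLongGeodesic_iff hl).1 γ.2
  let e : {p : ReducedLoop G // p.toLongGeodesic = γ} ≃ {p : List V | (p : Cycle V) = l} :=
    { toFun := fun p => ⟨p.1.1, (congrArg (fun γ : LongGeodesic G => γ.1.1) p.2).trans hl.symm⟩
      invFun := fun p => ⟨⟨p.1, by
          have hp : (p.1 : Cycle V) = γ.1.1 := p.2.trans hl
          exact ⟨hp ▸ γ.1.2, (Trajectory.isLongGeodesic_iff hp).1 γ.2⟩⟩,
        Subtype.ext (Subtype.ext (p.2.trans hl))⟩
      left_inv := fun p => rfl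
      right_inv := fun p => rfl }
  refine ⟨(e.finite_iff).2 (finite_coe_eq l).to_subtype, ?_⟩
  rw [Nat.card_congr e, Nat.card_coe_set_eq, ncard_coe_eq hg.1, Trajectory.primitiveLength_eq hl hg.1]

/-- One sum over based loops is grouped in two ways: by length, where the fibres have `loopCount`
elements, and by cyclic class, where they have `primitiveLength` elements. -/
theorem hasSum_longGeodesic [Finite V] (h : ℕ → ℂ)
    (hs : Summable fun n => (loopCount G n : ℝ) * ‖h n‖) {a : ℂ}
    (ha : HasSum (fun n => (loopCount G n : ℂ) * h n) a) :
    HasSum (fun γ : LongGeodesic G => (γ.1.primitiveLength : ℂ) * h γ.1.length) a := by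
  have h1 := (summable_comp_of_finite_fibers (fun p : ReducedLoop G => p.1.length)
    ReducedLoop.finite_length_eq h hs).hasSum
  have h2 := hasSum_of_hasSum_comp _ ReducedLoop.finite_length_eq h h1
  rw [h2.unique ha] at h1
  have h3 := hasSum_of_hasSum_comp (ReducedLoop.toLongGeodesic (G := G))
    (fun γ => γ.finite_fiber_and_card.1) (fun γ => h γ.1.length) h1
  refine h3.congr_fun ?_
  intro γ
  rw [γ.finite_fiber_and_card.2]

end Trajectories
-- Traces of matrix powers as sums over closed sequences
section PowerTraces

variable {D R : Type*} [Fintype D] [DecidableEq D] [CommSemiring R]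

theorem matrix_pow_succ_apply (M : Matrix D D R) (n : ℕ) (a b : D) :
    (M ^ (n + 1)) a b = ∑ f : Fin n → D, ∏ i : Fin (n + 1),
      M ((Fin.cons a f : Fin (n + 1) → D) i) ((Fin.snoc f b : Fin (n + 1) → D) i) := by
  induction n generalizing a with
  | zero => simp [Fin.snoc]
  | succ n ih =>
    rw [pow_succ', Matrix.mul_apply, ← (Fin.consEquiv fun _ => D).sum_comp, Fintype.sum_prod_type]
    refine Finset.sum_congr rfl fun c _ => ?_
    rw [ih, Finset.mul_sum]
    refine Finset.sum_congr rfl fun f _ => ?_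
    rw [Fin.prod_univ_succ (n := n + 1)]
    have h : (Fin.snoc ((Fin.consEquiv fun _ => D) (c, f)) b : Fin (n + 2) → D) =
        Fin.cons c (Fin.snoc f b : Fin (n + 1) → D) := (Fin.cons_snoc_eq_snoc_cons c f b).symm
    simp only [h, Fin.consEquiv_apply, Fin.cons_zero, Fin.cons_succ]

theorem trace_pow_succ (M : Matrix D D R) (n : ℕ) :
    (M ^ (n + 1)).trace = ∑ g : Fin (n + 1) → D, ∏ i, M (g i) (g (i + 1)) := by
  rw [Matrix.trace, ← (Fin.consEquiv fun _ => D).sum_comp, Fintype.sum_prod_type]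
  refine Finset.sum_congr rfl fun a _ => ?_
  rw [Matrix.diag_apply, matrix_pow_succ_apply]
  refine Finset.sum_congr rfl fun f _ => ?_
  refine Finset.prod_congr rfl fun i _ => ?_
  simp [Fin.snoc_eq_cons_rotate]

end PowerTraces

/-! ### The non-backtracking matrix and its traces -/

section EdgeMatrix

variable {V : Type*} [Fintype V] [DecidableEq V] (G : SimpleGraph V) [DecidableRel G.Adj]

/-- Hashimoto's non-backtracking matrix, indexed by oriented edges. -/
def edgeMatrix : Matrix G.Dart G.Dart ℂ :=
  Matrix.of fun e f => if e.snd = f.fst ∧ e.fst ≠ f.snd then 1 else 0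

/-- The incidence matrix of oriented edges with their heads. -/
def headMatrix : Matrix G.Dart V ℂ := Matrix.of fun e v => if e.snd = v then 1 else 0

/-- The incidence matrix of vertices with the oriented edges leaving them. -/
def tailMatrix : Matrix V G.Dart ℂ := Matrix.of fun v e => if v = e.fst then 1 else 0

/-- The permutation matrix of edge reversal. -/
def reversalMatrix : Matrix G.Dart G.Dart ℂ := Matrix.of fun e f => if f = e.symm then 1 else 0

omit [DecidableRel G.Adj] in
-- All continuations of an edge, minus the backtracking one. In a simple graph the reversed edge is
-- determined by its endpoints.
theorem edgeMatrix_eq : edgeMatrix G = headMatrix G * tailMatrix G - reversalMatrix G := by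
  ext e f
  have : f = e.symm ↔ e.snd = f.fst ∧ e.fst = f.snd := by
    rw [SimpleGraph.Dart.ext_iff, Prod.ext_iff]
    simp [eq_comm]
  simp only [edgeMatrix, headMatrix, tailMatrix, reversalMatrix, Matrix.of_apply, Matrix.sub_apply,
    Matrix.mul_apply, this, Finset.sum_ite_eq, Finset.mem_univ, if_true, ite_mul, one_mul, zero_mul]
  by_cases h1 : e.snd = f.fst <;> by_cases h2 : e.fst = f.snd <;> simp [h1, h2]

theorem reversalMatrix_mul_self : reversalMatrix G * reversalMatrix G = 1 := by
  ext e f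
  rw [Matrix.mul_apply, Finset.sum_eq_single e.symm]
  · simp [reversalMatrix, Matrix.one_apply, eq_comm]
  · intro j _ hj
    simp [reversalMatrix, hj]
  · simp

theorem reversalMatrix_mul_headMatrix :
    reversalMatrix G * headMatrix G = Matrix.of fun e v => if e.fst = v then 1 else 0 := by
  ext e v
  rw [Matrix.mul_apply, Finset.sum_eq_single e.symm]
  · simp [reversalMatrix, headMatrix]
  · intro j _ hj
    simp [reversalMatrix, hj]
  · simp

theorem tailMatrix_mul_headMatrix : tailMatrix G * headMatrix G = G.adjMatrix ℂ := by
  ext u v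
  simp only [tailMatrix, headMatrix, Matrix.mul_apply, Matrix.of_apply, SimpleGraph.adjMatrix_apply,
    ite_mul, one_mul, zero_mul, ← ite_and]
  by_cases h : G.Adj u v
  · rw [Finset.sum_eq_single (⟨(u, v), h⟩ : G.Dart)]
    · simp [h]
    · intro e _ he
      rw [if_neg]
      rintro ⟨rfl, rfl⟩
      exact he rfl
    · simp
  · rw [if_neg h]
    refine Finset.sum_eq_zero fun e _ => if_neg ?_
    rintro ⟨rfl, rfl⟩
    exact h e.adj

variable {G} {q : ℕ}

theorem tailMatrix_mul_reversalMatrix_mul_headMatrix (hreg : G.IsRegularOfDegree (q + 1)) :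
    tailMatrix G * (reversalMatrix G * headMatrix G) = ((q : ℂ) + 1) • 1 := by
  rw [reversalMatrix_mul_headMatrix]
  ext u v
  simp only [tailMatrix, Matrix.mul_apply, Matrix.of_apply, Matrix.smul_apply, Matrix.one_apply,
    ite_mul, one_mul, zero_mul, ← ite_and]
  by_cases h : u = v
  · subst h
    simp only [eq_comm (a := u), and_self, if_true, smul_eq_mul, mul_one]
    rw [Finset.sum_ite, Finset.sum_const_zero, add_zero, Finset.sum_const,
      SimpleGraph.dart_fst_fiber_card_eq_degree, hreg.degree_eq]
    simp
  · rw [if_neg h, smul_zero]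
    refine Finset.sum_eq_zero fun e _ => if_neg ?_
    rintro ⟨rfl, rfl⟩
    exact h rfl

open Polynomial in
-- With $H$, $J$ the head and reversal matrices, $BH=HA-JH$ and $BJH=qH$. Iterating these two
-- relations reproduces the recurrence $E_{n+2}=XE_{n+1}-qE_n$ of the second-kind Dickson
-- polynomials.
theorem edgeMatrix_pow_mul_headMatrix (hreg : G.IsRegularOfDegree (q + 1)) (n : ℕ) :
    edgeMatrix G ^ (n + 1) * headMatrix G =
      headMatrix G * aeval (G.adjMatrix ℂ) (dickson 2 (q : ℂ) (n + 1)) -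
        reversalMatrix G * headMatrix G * aeval (G.adjMatrix ℂ) (dickson 2 (q : ℂ) n) := by
  have h1 : edgeMatrix G * headMatrix G =
      headMatrix G * G.adjMatrix ℂ - reversalMatrix G * headMatrix G := by
    rw [edgeMatrix_eq, Matrix.sub_mul, Matrix.mul_assoc, tailMatrix_mul_headMatrix]
  have h2 : edgeMatrix G * (reversalMatrix G * headMatrix G) = (q : ℂ) • headMatrix G := by
    rw [edgeMatrix_eq, Matrix.sub_mul, Matrix.mul_assoc,
      tailMatrix_mul_reversalMatrix_mul_headMatrix hreg, ← Matrix.mul_assoc (reversalMatrix G),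
      reversalMatrix_mul_self, Matrix.one_mul, Matrix.mul_smul, Matrix.mul_one, add_smul, one_smul,
      add_sub_cancel_right]
  induction n with
  | zero =>
    rw [zero_add, pow_one, h1, dickson_one, dickson_zero, aeval_X]
    norm_num
  | succ n ih =>
    rw [pow_succ', Matrix.mul_assoc, ih, Matrix.mul_sub, ← Matrix.mul_assoc, h1,
      ← Matrix.mul_assoc, h2, dickson_add_two, map_sub, map_mul, map_mul, aeval_X, aeval_C,
      Matrix.sub_mul, Matrix.mul_sub, Algebra.algebraMap_eq_smul_one, Matrix.smul_mul,
      Matrix.smul_mul, Matrix.mul_smul, Matrix.one_mul, Matrix.mul_assoc]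
    abel

/-- Expanding the last factor by $B=HT-J$ ($T$ the tail matrix) and then $BJ=HTJ-1$ moves everything
to vertex matrices, except for $\operatorname{tr}B^n$. That leftover, two steps back, produces the
parity term. -/
theorem trace_edgeMatrix_pow_add_two (n : ℕ) :
    (edgeMatrix G ^ (n + 2)).trace = (tailMatrix G * (edgeMatrix G ^ (n + 1) * headMatrix G)).trace -
      (tailMatrix G * reversalMatrix G * (edgeMatrix G ^ n * headMatrix G)).trace +
        (edgeMatrix G ^ n).trace := by
  have h : edgeMatrix G ^ (n + 2) = edgeMatrix G ^ (n + 1) * headMatrix G * tailMatrix G -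
      edgeMatrix G ^ n * headMatrix G * (tailMatrix G * reversalMatrix G) + edgeMatrix G ^ n := by
    rw [pow_succ _ (n + 1)]
    conv_lhs => rw [edgeMatrix_eq]; rw [Matrix.mul_sub]; rw [← edgeMatrix_eq]
    rw [pow_succ, Matrix.mul_assoc _ (edgeMatrix G) (reversalMatrix G)]
    have : edgeMatrix G * reversalMatrix G =
        headMatrix G * (tailMatrix G * reversalMatrix G) - 1 := by
      rw [edgeMatrix_eq, Matrix.sub_mul, reversalMatrix_mul_self, Matrix.mul_assoc]
    rw [this, Matrix.mul_sub, Matrix.mul_one]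
    simp only [Matrix.mul_assoc]
    abel
  rw [h, Matrix.trace_add, Matrix.trace_sub, Matrix.trace_mul_comm,
    Matrix.trace_mul_comm _ (tailMatrix G * reversalMatrix G)]

open Polynomial in
theorem dickson_one_add_one {R : Type*} [CommRing R] (a : R) (n : ℕ) :
    dickson 1 a (n + 1) = 2 * dickson 2 a (n + 1) - X * dickson 2 a n := by
  induction n using Nat.twoStepInduction with
  | zero => simp only [zero_add, dickson_one, dickson_zero]; push_cast; ring
  | one => simp only [one_add_one_eq_two, dickson_two, dickson_one]; push_cast; ring
  | more n h1 h2 =>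
    rw [dickson_add_two, h1, h2, dickson_add_two 2 a (n + 1), dickson_add_two 2 a n]
    ring

open Polynomial in
theorem trace_edgeMatrix_pow (hreg : G.IsRegularOfDegree (q + 1)) (n : ℕ) :
    (edgeMatrix G ^ n).trace = (aeval (G.adjMatrix ℂ) (dickson 1 (q : ℂ) n)).trace +
      ((q : ℂ) - 1) / 2 * (1 + (-1) ^ n) * Fintype.card V := by
  have hA := tailMatrix_mul_headMatrix G
  have hJ := tailMatrix_mul_reversalMatrix_mul_headMatrix hreg
  induction n using Nat.twoStepInduction with
  | zero =>
    have : Fintype.card G.Dart = (q + 1) * Fintype.card V := by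
      rw [SimpleGraph.dart_card_eq_sum_degrees, Finset.sum_congr rfl fun v _ => hreg.degree_eq v]
      simp [mul_comm]
    rw [pow_zero, Matrix.trace_one, this, dickson_zero]
    -- `dickson k a 0` is the constant `3 - k`, here $2$ for the first kind.
    have h2 : (3 - ((1 : ℕ) : ℂ[X])) = C 2 := by norm_num; rfl
    rw [h2, aeval_C, Algebra.algebraMap_eq_smul_one, Matrix.trace_smul, Matrix.trace_one]
    push_cast
    rw [smul_eq_mul]
    ring
  | one =>
    rw [pow_one, dickson_one, aeval_X, SimpleGraph.trace_adjMatrix, Matrix.trace]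
    rw [Finset.sum_eq_zero]
    · ring
    · intro e _
      simp only [edgeMatrix, Matrix.diag_apply, Matrix.of_apply]
      exact if_neg fun h => e.adj.ne h.1.symm
  | more n h1 _ =>
    rw [trace_edgeMatrix_pow_add_two, h1, edgeMatrix_pow_mul_headMatrix hreg, Matrix.mul_sub,
      ← Matrix.mul_assoc, ← Matrix.mul_assoc, hA, hJ, Matrix.trace_sub]
    rw [dickson_one_add_one _ (n + 1)]
    -- The formula for $B^nH$ is available only for positive exponents, so $B^0H=H$ is treated
    -- separately.
    cases n with
    | zero =>
      simp only [pow_zero, Matrix.one_mul, zero_add, Matrix.mul_assoc, hJ, dickson_one, dickson_zero,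
        dickson_add_two]
      have h2 : (3 - ((1 : ℕ) : ℂ[X])) = C 2 := by norm_num; rfl
      have h3 : (3 - ((2 : ℕ) : ℂ[X])) = 1 := by norm_num
      have h4 : (2 : ℂ[X]) = C 2 := rfl
      rw [h2, h3, h4]
      simp only [map_sub, map_mul, aeval_X, aeval_C, map_one, Algebra.algebraMap_eq_smul_one,
        Matrix.trace_sub, Matrix.trace_smul, Matrix.trace_one, smul_mul_assoc, one_mul, mul_one,
        mul_sub, smul_eq_mul, mul_smul_comm]
      ring
    | succ m =>
      rw [edgeMatrix_pow_mul_headMatrix hreg, Matrix.mul_sub, Matrix.mul_assoc, ← Matrix.mul_assoc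
        (reversalMatrix G) (headMatrix G), ← Matrix.mul_assoc (tailMatrix G), hJ,
        Matrix.mul_assoc (tailMatrix G) (reversalMatrix G), ← Matrix.mul_assoc (reversalMatrix G)
        (reversalMatrix G * _), ← Matrix.mul_assoc (reversalMatrix G) (reversalMatrix G),
        reversalMatrix_mul_self, Matrix.one_mul, ← Matrix.mul_assoc, hA, dickson_one_add_one,
        dickson_add_two 2 _ (m + 1)]
      have h4 : (2 : ℂ[X]) = C 2 := rfl
      rw [h4]
      simp only [map_sub, map_mul, aeval_X, aeval_C, Algebra.algebraMap_eq_smul_one,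
        Matrix.trace_sub, Matrix.trace_smul, smul_mul_assoc, one_mul,
        mul_sub, smul_eq_mul, mul_smul_comm, pow_succ]
      ring

end EdgeMatrix
-- Counting reduced loops by a trace
section LoopCount

variable {V : Type*} [Fintype V] [DecidableEq V] {G : SimpleGraph V} [DecidableRel G.Adj]

/-- Reduced loops as cyclic sequences of oriented edges. -/
def reducedLoopEquiv (n : ℕ) : {p : ReducedLoop G // p.1.length = n + 1} ≃
    {g : Fin (n + 1) → G.Dart // ∀ i, (g i).snd = (g (i + 1)).fst ∧ (g i).fst ≠ (g (i + 1)).snd} where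
  toFun p := ⟨fun i => ⟨(p.1.1[i.1]'(p.2.symm ▸ i.2),
      p.1.1[(i.1 + 1) % p.1.1.length]'(Nat.mod_lt _ (p.2.symm ▸ n.succ_pos))),
      (chain_coe_iff _ _).1 p.1.2.1 _ _⟩, by
    obtain ⟨⟨p, h1, h2, h3⟩, hp⟩ := p
    intro i
    have e : ((i + 1 : Fin (n + 1)) : ℕ) = (i.1 + 1) % p.length := by
      rw [Fin.val_add, Fin.val_one', Nat.add_mod_mod, show p.length = n + 1 from hp]
    refine ⟨?_, ?_⟩
    · simp only [e]
    · simp only [e, Nat.mod_add_mod]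
      exact h3 i _⟩
  invFun g := ⟨⟨List.ofFn fun i => (g.1 i).fst, by
    have key1 : ∀ (i : ℕ) (hi : i < n + 1), (⟨(i + 1) % (n + 1), Nat.mod_lt _ n.succ_pos⟩ :
        Fin (n + 1)) = ⟨i, hi⟩ + 1 := by
      intro i hi
      ext
      simp [Fin.val_add]
    have key2 : ∀ (i : ℕ) (hi : i < n + 1), (⟨(i + 2) % (n + 1), Nat.mod_lt _ n.succ_pos⟩ :
        Fin (n + 1)) = ⟨i, hi⟩ + 1 + 1 := by
      intro i hi
      ext
      simp [Fin.val_add]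
    refine ⟨(chain_coe_iff _ _).2 fun i hi => ?_, by simp, fun i hi => ?_⟩
    · simp only [List.getElem_ofFn, List.length_ofFn] at hi ⊢
      rw [key1 i hi, ← (g.2 ⟨i, hi⟩).1]
      exact (g.1 ⟨i, hi⟩).adj
    · simp only [List.getElem_ofFn, List.length_ofFn] at hi ⊢
      -- The vertex two steps ahead is the head of the next edge, so $v_i\ne v_{i+2}$ is the
      -- non-backtracking condition.
      rw [key2 i hi, ← (g.2 (⟨i, hi⟩ + 1)).1]
      exact (g.2 ⟨i, hi⟩).2⟩, by simp⟩
  left_inv p := by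
    obtain ⟨⟨p, h1, h2, h3⟩, hp⟩ := p
    refine Subtype.ext (Subtype.ext (List.ext_getElem (by simp [hp]) fun i h1 h2 => ?_))
    exact List.getElem_ofFn _
  right_inv g := by
    refine Subtype.ext (funext fun i => ?_)
    have e : (⟨(i.1 + 1) % (n + 1), Nat.mod_lt _ n.succ_pos⟩ : Fin (n + 1)) = i + 1 := by
      ext; simp [Fin.val_add]
    ext1
    refine Prod.ext (List.getElem_ofFn _) ?_
    simp only [List.getElem_ofFn, List.length_ofFn, e]
    exact (g.2 i).1.symm

theorem loopCount_succ (n : ℕ) : (loopCount G (n + 1) : ℂ) = (edgeMatrix G ^ (n + 1)).trace := by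
  rw [loopCount, Nat.card_congr (reducedLoopEquiv n), Nat.card_eq_fintype_card,
    Fintype.card_subtype, trace_pow_succ]
  simp only [edgeMatrix, Matrix.of_apply, Finset.prod_ite_zero, Finset.mem_univ, true_imp_iff,
    Finset.prod_const_one, Finset.sum_boole]

end LoopCount

/-! ### Eigenvalues of the averaging operator -/

section Eigenvalues

open Polynomial

theorem trace_aeval_eq_sum_eigenvalues {n : Type*} [Fintype n] [DecidableEq n]
    {A : Matrix n n ℂ} (hA : A.IsHermitian) (p : ℂ[X]) :
    (aeval A p).trace = ∑ i, p.eval (hA.eigenvalues i : ℂ) := by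
  conv_lhs => rw [hA.spectral_theorem]
  have h := aeval_algHom_apply
    (Unitary.conjStarAlgAut ℂ _ hA.eigenvectorUnitary).toAlgEquiv.toAlgHom
    (Matrix.diagonal (RCLike.ofReal ∘ hA.eigenvalues)) p
  have h2 := aeval_algHom_apply (Matrix.diagonalAlgHom (n := n) (α := ℂ) ℂ)
    (RCLike.ofReal ∘ hA.eigenvalues) p
  have h3 : aeval (Unitary.conjStarAlgAut ℂ _ hA.eigenvectorUnitary
      (Matrix.diagonal (RCLike.ofReal ∘ hA.eigenvalues))) p =
      Unitary.conjStarAlgAut ℂ _ hA.eigenvectorUnitary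
        (Matrix.diagonal (aeval (RCLike.ofReal ∘ hA.eigenvalues : n → ℂ) p)) := by
    exact h.trans (congrArg _ h2)
  rw [h3, Unitary.conjStarAlgAut_apply, Matrix.trace_mul_comm, ← mul_assoc]
  simp [Matrix.trace, Polynomial.aeval_pi, Polynomial.aeval_def, Polynomial.eval₂_eq_eval_map]

theorem eval_dickson_add {R : Type*} [CommRing R] (a b : R) (n : ℕ) :
    (dickson 1 (a * b) n).eval (a + b) = a ^ n + b ^ n := by
  induction n using Nat.twoStepInduction with
  | zero => simp only [dickson_zero]; norm_num
  | one => simp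
  | more n h1 h2 =>
    rw [dickson_add_two, eval_sub, eval_mul, eval_mul, h1, h2, eval_X, eval_C]
    ring

variable {V : Type*} [Fintype V] {G : SimpleGraph V} [DecidableRel G.Adj] [DecidableEq V]

variable (G) in
/-- The eigenvalues of the averaging operator, with multiplicity. -/
noncomputable def graphEigenvalues : V → ℝ := (G.isHermitian_adjMatrix ℂ).eigenvalues

theorem averagingOperator_eq_toLin' :
    averagingOperator G = Matrix.toLin' (G.adjMatrix ℂ) := by
  refine LinearMap.ext fun f => funext fun v => ?_
  rw [Matrix.toLin'_apply, SimpleGraph.adjMatrix_mulVec_apply]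
  rfl

theorem spectralDensity_eq_sum (φ : ℂ → ℂ) :
    spectralDensity G φ = ∑ v, φ (graphEigenvalues G v : ℂ) := by
  rw [spectralDensity, averagingOperator_eq_toLin', Matrix.charpoly_toLin',
    (G.isHermitian_adjMatrix ℂ).roots_charpoly_eq_eigenvalues, Multiset.map_map]
  rfl

/-- Gershgorin's theorem: the diagonal vanishes and each row has absolute sum $d$. With $d=q+1$ this
places the spectrum in the elliptic region. -/
theorem abs_graphEigenvalues_le {d : ℕ} (hreg : G.IsRegularOfDegree d) (v : V) :
    |graphEigenvalues G v| ≤ d := by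
  have h : Module.End.HasEigenvalue (Matrix.toLin' (G.adjMatrix ℂ)) (graphEigenvalues G v : ℂ) := by
    rw [Module.End.hasEigenvalue_iff_isRoot_charpoly, Matrix.charpoly_toLin',
      ← Polynomial.mem_roots (Matrix.charpoly_monic _).ne_zero,
      (G.isHermitian_adjMatrix ℂ).roots_charpoly_eq_eigenvalues]
    exact Multiset.mem_map.2 ⟨v, Finset.mem_univ _, rfl⟩
  obtain ⟨k, hk⟩ := eigenvalue_mem_ball h
  rw [SimpleGraph.adjMatrix_apply, if_neg (G.irrefl), mem_closedBall_zero_iff] at hk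
  rw [Complex.norm_real, Real.norm_eq_abs] at hk
  refine hk.trans ((Finset.sum_le_univ_sum_of_nonneg fun _ => norm_nonneg _).trans_eq ?_)
  have : ∀ j, ‖G.adjMatrix ℂ k j‖ = if G.Adj k j then 1 else 0 := by
    intro j; rw [SimpleGraph.adjMatrix_apply]; split_ifs <;> simp
  rw [Finset.sum_congr rfl fun j _ => this j, Finset.sum_boole, ← hreg.degree_eq k,
    SimpleGraph.degree, SimpleGraph.neighborFinset_eq_filter]

theorem loopCount_eq {q : ℕ} (hreg : G.IsRegularOfDegree (q + 1)) (n : ℕ) :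
    (loopCount G (n + 1) : ℂ) =
      ∑ v, (dickson 1 (q : ℂ) (n + 1)).eval (graphEigenvalues G v : ℂ) +
        ((q : ℂ) - 1) / 2 * (1 + (-1) ^ (n + 1)) * Fintype.card V := by
  rw [loopCount_succ, trace_edgeMatrix_pow hreg,
    trace_aeval_eq_sum_eigenvalues (G.isHermitian_adjMatrix ℂ)]
  rfl

omit [Fintype V] [DecidableRel G.Adj] [DecidableEq V] in
-- Reduced loops have positive length by definition, whereas $\operatorname{tr}B^0$ counts oriented
-- edges. The trace formula is thus used only for $n\ge1$.
theorem loopCount_zero : loopCount G 0 = 0 := by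
  have : IsEmpty {p : ReducedLoop G // p.1.length = 0} :=
    ⟨fun p => p.1.2.2.1.ne' p.2⟩
  rw [loopCount, Nat.card_of_isEmpty]

end Eigenvalues
-- The Joukowski map and the elliptic region
section Joukowski

open Complex

/-- The map `z ↦ √q (z + 1/z)`, sending the circle `|z| = √q` to the boundary of the elliptic
region. -/
noncomputable def joukowski (q : ℕ) (z : ℂ) : ℂ := ((Real.sqrt q : ℝ) : ℂ) * (z + z⁻¹)

theorem joukowski_inv (q : ℕ) (z : ℂ) : joukowski q z⁻¹ = joukowski q z := by
  rw [joukowski, joukowski, inv_inv, add_comm]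

/-- With $z=u^2$ the two terms are $\sqrt q\,|u\mp u^{-1}|^2$, and the parallelogram law adds them.
-/
theorem norm_joukowski_sub_add (q : ℕ) {z : ℂ} (hz : z ≠ 0) :
    ‖joukowski q z - ((2 * Real.sqrt q : ℝ) : ℂ)‖ + ‖joukowski q z + ((2 * Real.sqrt q : ℝ) : ℂ)‖ =
      2 * (Real.sqrt q * (‖z‖ + ‖z‖⁻¹)) := by
  obtain ⟨u, hu⟩ := IsAlgClosed.exists_pow_nat_eq z (n := 2) two_pos
  have hu0 : u ≠ 0 := by rintro rfl; simp at hu; exact hz hu.symm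
  have h1 : joukowski q z - ((2 * Real.sqrt q : ℝ) : ℂ) = (Real.sqrt q : ℝ) * (u - u⁻¹) ^ 2 := by
    rw [joukowski, ← hu]; push_cast; field_simp; ring
  have h2 : joukowski q z + ((2 * Real.sqrt q : ℝ) : ℂ) = (Real.sqrt q : ℝ) * (u + u⁻¹) ^ 2 := by
    rw [joukowski, ← hu]; push_cast; field_simp; ring
  have h3 := parallelogram_law_with_norm ℝ u u⁻¹
  have h4 : ‖z‖ = ‖u‖ * ‖u‖ := by rw [← hu, norm_pow, sq]
  rw [h1, h2, norm_mul, norm_mul, norm_pow, norm_pow, norm_real, Real.norm_eq_abs,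
    abs_of_nonneg (Real.sqrt_nonneg _), h4, mul_inv, ← norm_inv]
  linear_combination Real.sqrt q * h3

theorem joukowski_mem_ellipticRegion_iff {q : ℕ} (hq : 1 ≤ q) {z : ℂ} (hz : z ≠ 0) :
    joukowski q z ∈ ellipticRegion q ↔ ‖z‖ ≤ Real.sqrt q ∧ ‖z‖⁻¹ ≤ Real.sqrt q := by
  have hs : 1 ≤ Real.sqrt q := Real.one_le_sqrt.2 (by exact_mod_cast hq)
  have hs2 : Real.sqrt q * Real.sqrt q = q := Real.mul_self_sqrt (by positivity)
  have ht : 0 < ‖z‖ := norm_pos_iff.2 hz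
  rw [ellipticRegion, Set.mem_ofPred_eq, norm_joukowski_sub_add q hz]
  set s := Real.sqrt q
  set t := ‖z‖
  -- Since $s^2=q$, the quadratic in $t$ has roots $s$ and $1/s$.
  have key : (s * (t + t⁻¹) ≤ q + 1) ↔ (t - s) * (s * t - 1) ≤ 0 := by
    have e : (s * (t + t⁻¹) - (q + 1)) * t = (t - s) * (s * t - 1) := by
      field_simp
      linear_combination t * hs2
    rw [← e, ← sub_nonpos]
    constructor
    · intro h; exact mul_nonpos_of_nonpos_of_nonneg h ht.le
    · intro h; exact nonpos_of_mul_nonpos_left h ht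
  rw [mul_le_mul_iff_right₀ two_pos, key, inv_le_iff_one_le_mul₀ ht]
  constructor
  · intro h
    constructor
    · by_contra! h1
      have : 0 < s * t - 1 := by nlinarith
      nlinarith [mul_pos (sub_pos.2 h1) this]
    · by_contra! h1
      have : t < s := by nlinarith
      nlinarith [mul_pos (sub_pos.2 h1) (sub_pos.2 this)]
  · rintro ⟨h1, h2⟩
    exact mul_nonpos_of_nonpos_of_nonneg (by linarith) (by linarith)

theorem exists_joukowski_eq {q : ℕ} (hq : 1 ≤ q) (x : ℂ) : ∃ z : ℂ, z ≠ 0 ∧ joukowski q z = x := by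
  have hs : ((Real.sqrt q : ℝ) : ℂ) ≠ 0 := by
    rw [ofReal_ne_zero]
    exact (Real.sqrt_pos.2 (by exact_mod_cast hq)).ne'
  set s : ℂ := ((Real.sqrt q : ℝ) : ℂ)
  obtain ⟨d, hd⟩ := IsAlgClosed.exists_pow_nat_eq ((x / (2 * s)) ^ 2 - 1) (n := 2) two_pos
  have h1 : (x / (2 * s) + d) * (x / (2 * s) - d) = 1 := by linear_combination -hd
  refine ⟨x / (2 * s) + d, left_ne_zero_of_mul_eq_one h1, ?_⟩
  rw [joukowski, inv_eq_of_mul_eq_one_right h1]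
  change s * _ = x
  field_simp
  ring

theorem ofReal_mem_ellipticRegion {q : ℕ} {x : ℝ} (hx : |x| ≤ q + 1) :
    (x : ℂ) ∈ ellipticRegion q := by
  have hs2 : Real.sqrt q * Real.sqrt q = q := Real.mul_self_sqrt (by positivity)
  rw [ellipticRegion, Set.mem_ofPred_eq, ← ofReal_sub, ← ofReal_add, norm_real, norm_real,
    Real.norm_eq_abs, Real.norm_eq_abs]
  have := sq_nonneg (Real.sqrt q - 1)
  have := Real.sqrt_nonneg (q : ℝ)
  rw [abs_le] at hx
  rcases abs_cases (x - 2 * Real.sqrt q) with ⟨h1, _⟩ | ⟨h1, _⟩ <;>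
    rcases abs_cases (x + 2 * Real.sqrt q) with ⟨h2, _⟩ | ⟨h2, _⟩ <;> rw [h1, h2] <;> nlinarith

theorem continuousAt_joukowski (q : ℕ) {z : ℂ} (hz : z ≠ 0) : ContinuousAt (joukowski q) z :=
  continuousAt_const.mul (continuousAt_id.add (continuousAt_inv₀ hz))

theorem differentiableAt_joukowski (q : ℕ) {z : ℂ} (hz : z ≠ 0) :
    DifferentiableAt ℂ (joukowski q) z :=
  (differentiableAt_id.add (differentiableAt_inv hz)).const_mul _

/-- The compact annulus $1\le|z|\le\sqrt q$ maps into the region, so analyticity persists on a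
thickening of it. The symmetry $z\mapsto z^{-1}$ covers $|z|<1$. -/
theorem IsTestFunction.exists_radius {q : ℕ} (hq : 1 ≤ q) {φ : ℂ → ℂ} (hφ : IsTestFunction q φ) :
    ∃ R : ℝ, Real.sqrt q < R ∧
      ∀ z : ℂ, ‖z‖ ≤ R → ‖z‖⁻¹ ≤ R → z ≠ 0 → AnalyticAt ℂ φ (joukowski q z) := by
  have hs : 1 ≤ Real.sqrt q := Real.one_le_sqrt.2 (by exact_mod_cast hq)
  set s := Real.sqrt q
  set K : Set ℂ := Metric.closedBall 0 s \ Metric.ball 0 1 with hK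
  have hKc : IsCompact K := (isCompact_closedBall 0 s).diff Metric.isOpen_ball
  set W : Set ℂ := {0}ᶜ ∩ joukowski q ⁻¹' {x | AnalyticAt ℂ φ x} with hW
  have hWo : IsOpen W := ContinuousOn.isOpen_inter_preimage
    (fun z hz => (continuousAt_joukowski q hz).continuousWithinAt) isOpen_compl_singleton
    (isOpen_analyticAt ℂ φ)
  have hKW : K ⊆ W := by
    intro z hz
    simp only [hK, Set.mem_sdiff, mem_closedBall_zero_iff, mem_ball_zero_iff, not_lt] at hz
    have hz0 : z ≠ 0 := norm_pos_iff.1 (by linarith)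
    refine ⟨hz0, hφ _ ((joukowski_mem_ellipticRegion_iff hq hz0).2 ⟨hz.1, ?_⟩)⟩
    exact (inv_le_one_of_one_le₀ hz.2).trans hs
  obtain ⟨δ, hδ, hthick⟩ := hKc.exists_thickening_subset_open hWo hKW
  have main : ∀ z : ℂ, 1 ≤ ‖z‖ → ‖z‖ ≤ s + δ / 2 → AnalyticAt ℂ φ (joukowski q z) := by
    intro z h1 h2
    by_cases h3 : ‖z‖ ≤ s
    · exact (hKW (by simp [hK, h1, h3] : z ∈ K)).2
    have hz0 : 0 < ‖z‖ := by linarith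
    -- The nearby point of the annulus is the radial projection of $z$ to $|z|=\sqrt q$, at distance
    -- $|z|-\sqrt q\le\delta/2$.
    refine (hthick (Metric.mem_thickening_iff.2 ⟨((s / ‖z‖ : ℝ) : ℂ) * z, ?_, ?_⟩)).2
    · have : ‖((s / ‖z‖ : ℝ) : ℂ) * z‖ = s := by
        rw [norm_mul, norm_real, Real.norm_eq_abs, abs_of_nonneg (by positivity)]
        field_simp
      rw [hK, Set.mem_sdiff, mem_closedBall_zero_iff, mem_ball_zero_iff, this]
      exact ⟨le_rfl, not_lt.2 hs⟩
    · have : z - ((s / ‖z‖ : ℝ) : ℂ) * z = ((1 - s / ‖z‖ : ℝ) : ℂ) * z := by push_cast; ring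
      rw [dist_eq_norm, this, norm_mul, norm_real, Real.norm_eq_abs, abs_of_nonneg, sub_mul,
        div_mul_cancel₀ _ hz0.ne', one_mul]
      · linarith
      · rw [sub_nonneg, div_le_one hz0]; exact (not_le.1 h3).le
  refine ⟨s + δ / 2, by linarith, fun z h1 h2 hz => ?_⟩
  rcases le_total 1 ‖z‖ with h | h
  · exact main z h h1
  · rw [← joukowski_inv]
    refine main _ ?_ (by rwa [norm_inv])
    rw [norm_inv]
    exact (one_le_inv₀ (norm_pos_iff.2 hz)).2 h

end Joukowski

/-! ### Circle integrals under inversion and change of radius -/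

section CircleIntegrals

open Complex

theorem circleIntegral_inv_smul {R : ℝ} (hR : R ≠ 0) (h : ℂ → ℂ) :
    (∮ z in C(0, R), z⁻¹ • h z) = ∫ θ in (0 : ℝ)..2 * Real.pi, I * h (circleMap 0 R θ) := by
  rw [circleIntegral]
  refine intervalIntegral.integral_congr fun θ _ => ?_
  have : circleMap 0 R θ ≠ 0 := circleMap_ne_center hR
  simp only [deriv_circleMap, smul_eq_mul]
  field_simp

theorem circleIntegral_inv_smul_comp_inv {R : ℝ} (hR : R ≠ 0) (h : ℂ → ℂ) :
    (∮ z in C(0, R⁻¹), z⁻¹ • h z⁻¹) = ∮ z in C(0, R), z⁻¹ • h z := by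
  rw [circleIntegral_inv_smul (inv_ne_zero hR) (fun z => h z⁻¹), circleIntegral_inv_smul hR]
  have := intervalIntegral.integral_comp_sub_left (a := 0) (b := 2 * Real.pi)
    (fun θ => I * h (circleMap 0 R θ)) (2 * Real.pi)
  rw [sub_self, sub_zero] at this
  rw [← this]
  refine intervalIntegral.integral_congr fun θ _ => ?_
  have e : (circleMap 0 R⁻¹ θ)⁻¹ = circleMap 0 R (2 * Real.pi - θ) := by
    simp only [circleMap, zero_add, mul_inv, ofReal_inv, inv_inv, ← Complex.exp_neg]
    congr 1
    rw [← Complex.exp_periodic]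
    congr 1
    push_cast
    ring
  simp only [e]

theorem circleIntegral_eq_circleIntegral_inv {R : ℝ} (hR : 1 ≤ R) {g : ℂ → ℂ}
    (hg : ∀ z : ℂ, ‖z‖ ≤ R → ‖z‖⁻¹ ≤ R → z ≠ 0 → DifferentiableAt ℂ g z) {r : ℝ} (hr : r ≤ R)
    (hr' : R⁻¹ ≤ r) :
    (∮ z in C(0, R), z⁻¹ • g z) = ∮ z in C(0, r), z⁻¹ • g z := by
  have hR0 : 0 < R := by linarith
  have hr0 : 0 < r := lt_of_lt_of_le (inv_pos.2 hR0) hr'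
  have h : ∀ z : ℂ, ‖z‖ ≤ R → r ≤ ‖z‖ → DifferentiableAt ℂ g z := by
    intro z h1 h2
    have hz : 0 < ‖z‖ := by linarith
    refine hg z h1 ?_ (norm_pos_iff.1 hz)
    exact inv_le_of_inv_le₀ hR0 (hr'.trans h2)
  have := circleIntegral_sub_center_inv_smul_eq_of_differentiable_on_annulus_off_countable (c := 0)
    hr0 hr (s := ∅) (f := g) Set.countable_empty
    (fun z hz => (h z (by simpa using hz.1) (by simpa using hz.2)).continuousAt.continuousWithinAt)
    (fun z hz => h z (by simpa using (Metric.ball_subset_closedBall hz.1.1))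
      (le_of_lt (by simpa using hz.1.2)))
  simpa only [sub_zero] using this

end CircleIntegrals
-- Chebyshev expansion of test functions
section CosineExpansion

open Complex

/-- The Chebyshev coefficients of a test function, as Fourier cosine coefficients. -/
noncomputable def cosCoeff (q : ℕ) (φ : ℂ → ℂ) (n : ℕ) : ℂ :=
  (Real.pi : ℂ)⁻¹ * ∫ θ in (0 : ℝ)..Real.pi,
    φ ((2 * Real.sqrt q * Real.cos θ : ℝ) : ℂ) * (Real.cos (n * θ) : ℂ)

theorem joukowski_circleMap (q : ℕ) (θ : ℝ) :
    joukowski q (circleMap 0 1 θ) = ((2 * Real.sqrt q * Real.cos θ : ℝ) : ℂ) := by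
  simp only [joukowski, circleMap, zero_add, ofReal_one, one_mul, ← Complex.exp_neg]
  push_cast
  rw [Complex.cos, ← neg_mul]
  ring

theorem ofReal_two_sqrt_mul_cos_mem {q : ℕ} (θ : ℝ) :
    ((2 * Real.sqrt q * Real.cos θ : ℝ) : ℂ) ∈ ellipticRegion q := by
  refine ofReal_mem_ellipticRegion ?_
  have hs2 : Real.sqrt q * Real.sqrt q = q := Real.mul_self_sqrt (by positivity)
  rw [abs_mul, abs_of_nonneg (by positivity)]
  have := Real.abs_cos_le_one θ
  have := Real.sqrt_nonneg (q : ℝ)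
  nlinarith [sq_nonneg (Real.sqrt q - 1)]

theorem IsTestFunction.continuous_comp_cos {q : ℕ} {φ : ℂ → ℂ} (hφ : IsTestFunction q φ) :
    Continuous fun θ : ℝ => φ ((2 * Real.sqrt q * Real.cos θ : ℝ) : ℂ) := by
  refine continuous_iff_continuousAt.2 fun θ => ?_
  refine ContinuousAt.comp (f := fun θ : ℝ => ((2 * Real.sqrt q * Real.cos θ : ℝ) : ℂ))
    (hφ _ (ofReal_two_sqrt_mul_cos_mem θ)).continuousAt ?_
  fun_prop

variable {q : ℕ} {φ : ℂ → ℂ}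

/-- The factor $\varphi(2\sqrt q\cos\theta)$ is even about $\theta=\pi$, so folding the circle onto
$[0,\pi]$ replaces the exponential by a cosine. -/
theorem circleIntegral_one_eq_cosCoeff (hφ : IsTestFunction q φ) (n : ℕ) :
    (∮ z in C(0, 1), z⁻¹ • (φ (joukowski q z) * z⁻¹ ^ n)) =
      2 * Real.pi * I * cosCoeff q φ n := by
  have hpi : (Real.pi : ℂ) ≠ 0 := ofReal_ne_zero.2 Real.pi_ne_zero
  have hc := hφ.continuous_comp_cos
  have hcont : Continuous fun θ : ℝ => I * (φ ((2 * Real.sqrt q * Real.cos θ : ℝ) : ℂ) *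
      Complex.exp (-(n * θ * I))) := continuous_const.mul (hc.mul (by fun_prop))
  have hci := hcont.intervalIntegrable (μ := volume)
  have e1 : ∀ θ : ℝ, I * (φ (joukowski q (circleMap 0 1 θ)) * (circleMap 0 1 θ)⁻¹ ^ n) =
      I * (φ ((2 * Real.sqrt q * Real.cos θ : ℝ) : ℂ) * Complex.exp (-(n * θ * I))) := by
    intro θ
    rw [joukowski_circleMap]
    simp only [circleMap, zero_add, ofReal_one, one_mul, ← Complex.exp_neg, ← Complex.exp_nat_mul]
    congr 3
    ring
  rw [circleIntegral_inv_smul one_ne_zero, intervalIntegral.integral_congr fun θ _ => e1 θ,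
    ← intervalIntegral.integral_add_adjacent_intervals (hci 0 Real.pi) (hci Real.pi (2 * Real.pi))]
  have h2 := intervalIntegral.integral_comp_sub_left (a := 0) (b := Real.pi)
    (fun θ : ℝ => I * (φ ((2 * Real.sqrt q * Real.cos θ : ℝ) : ℂ) * Complex.exp (-(n * θ * I))))
    (2 * Real.pi)
  rw [sub_zero, show 2 * Real.pi - Real.pi = Real.pi by ring] at h2
  have hci2 : IntervalIntegrable (fun θ : ℝ =>
      I * (φ ((2 * Real.sqrt q * Real.cos (2 * Real.pi - θ) : ℝ) : ℂ) *
        Complex.exp (-(n * ((2 * Real.pi - θ : ℝ) : ℂ) * I)))) volume 0 Real.pi :=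
    (hcont.comp (continuous_const.sub continuous_id :
      Continuous fun θ : ℝ => 2 * Real.pi - θ)).intervalIntegrable 0 Real.pi
  rw [← h2, ← intervalIntegral.integral_add (hci _ _) hci2, cosCoeff, mul_assoc (2 * (Real.pi : ℂ)),
    ← mul_assoc I, mul_comm I, ← mul_assoc, ← mul_assoc, mul_assoc 2, mul_inv_cancel₀ hpi, mul_one,
    ← intervalIntegral.integral_const_mul]
  refine intervalIntegral.integral_congr fun θ _ => ?_
  have e2 : Complex.exp (-(n * ((2 * Real.pi - θ : ℝ) : ℂ) * I)) = Complex.exp (n * θ * I) := by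
    rw [Complex.exp_eq_exp_iff_exists_int]
    refine ⟨-n, ?_⟩
    push_cast
    ring
  simp only [Real.cos_two_pi_sub, e2]
  have e3 : ((Real.cos (n * θ) : ℝ) : ℂ) =
      (Complex.exp (n * θ * I) + Complex.exp (-(n * θ * I))) / 2 := by
    rw [ofReal_cos, Complex.cos]
    push_cast
    rw [neg_mul]
  rw [e3]
  ring

/-- The expansion of a test function at a point `√q (w + 1/w)` of the elliptic region. -/
theorem IsTestFunction.hasSum_cosCoeff (hq : 1 ≤ q) (hφ : IsTestFunction q φ) {w : ℂ} (hw : w ≠ 0)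
    (hmem : joukowski q w ∈ ellipticRegion q) :
    HasSum (fun n => (w ^ n + w⁻¹ ^ n) * cosCoeff q φ n)
      (φ (joukowski q w) + cosCoeff q φ 0) := by
  obtain ⟨R, hR, hφR⟩ := hφ.exists_radius hq
  obtain ⟨hw1, hw2⟩ := (joukowski_mem_ellipticRegion_iff hq hw).1 hmem
  have hs : 1 ≤ Real.sqrt q := Real.one_le_sqrt.2 (by exact_mod_cast hq)
  have hR1 : 1 < R := lt_of_le_of_lt hs hR
  have hR0 : 0 < R := by linarith
  have hwR : ‖w‖ < R := hw1.trans_lt hR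
  have hwR' : ‖w⁻¹‖ < R := by rw [norm_inv]; exact hw2.trans_lt hR
  have hpi : (2 * Real.pi * I : ℂ) ≠ 0 := two_pi_I_ne_zero
  set F : ℂ → ℂ := fun z => φ (joukowski q z) with hF
  have hFd : ∀ z : ℂ, ‖z‖ ≤ R → ‖z‖⁻¹ ≤ R → z ≠ 0 → DifferentiableAt ℂ F z :=
    fun z h1 h2 h3 => (hφR z h1 h2 h3).differentiableAt.comp z (differentiableAt_joukowski q h3)
  have hRc : ∀ z ∈ Metric.sphere (0 : ℂ) R, ‖z‖ ≤ R ∧ ‖z‖⁻¹ ≤ R ∧ z ≠ 0 := by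
    intro z hz
    have : ‖z‖ = R := mem_sphere_zero_iff_norm.1 hz
    refine ⟨this.le, ?_, norm_pos_iff.1 (by rw [this]; exact hR0)⟩
    rw [this]
    exact (inv_le_one_of_one_le₀ hR1.le).trans hR1.le
  have hFc : ContinuousOn F (Metric.sphere 0 R) := fun z hz =>
    (hFd z (hRc z hz).1 (hRc z hz).2.1 (hRc z hz).2.2).continuousAt.continuousWithinAt
  have hFi : CircleIntegrable F 0 R := hFc.circleIntegrable hR0.le
  have hcoef : ∀ n, (∮ z in C(0, R), z⁻¹ • (F z * z⁻¹ ^ n)) = 2 * Real.pi * I * cosCoeff q φ n := by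
    intro n
    rw [← circleIntegral_one_eq_cosCoeff hφ n]
    refine circleIntegral_eq_circleIntegral_inv hR1.le ?_ hR1.le (inv_le_one_of_one_le₀ hR1.le)
    intro z h1 h2 h3
    exact (hFd z h1 h2 h3).mul ((differentiableAt_inv h3).pow n)
  -- The Cauchy kernel on $|z|=R$ is expanded in powers of $v$. The function $F$ need not be
  -- holomorphic inside the circle: the integral is not claimed to equal $F(v)$.
  have hsum : ∀ v : ℂ, ‖v‖ < R → HasSum (fun n => v ^ n * (2 * Real.pi * I * cosCoeff q φ n))
      (∮ z in C(0, R), (z - v)⁻¹ • F z) := by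
    intro v hv
    have := hasSum_two_pi_I_cauchyPowerSeries_integral hFi hv
    simp only [sub_zero, zero_add] at this
    refine this.congr_fun fun n => ?_
    rw [← hcoef, ← circleIntegral.integral_const_mul]
    refine congrArg (fun f => circleIntegral f 0 R) (funext fun z => ?_)
    simp only [smul_eq_mul, div_pow, inv_pow]
    ring
  set x := joukowski q w with hx
  -- The difference quotient of $\varphi$ at $x$ splits $F$ into a constant and a multiple of
  -- $J(z)-x$, with $J$ the map `joukowski q`. This avoids residues and a separate case $w=w^{-1}$.
  set ψ := dslope φ x with hψ
  have hψd : ∀ z : ℂ, ‖z‖ ≤ R → ‖z‖⁻¹ ≤ R → z ≠ 0 → DifferentiableAt ℂ ψ (joukowski q z) := by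
    intro z h1 h2 h3
    have hopen := isOpen_analyticAt ℂ φ
    have hxU : x ∈ {y | AnalyticAt ℂ φ y} :=
      hφR w hwR.le (by rw [← norm_inv]; exact hwR'.le) hw
    have hd : DifferentiableOn ℂ φ {y | AnalyticAt ℂ φ y} :=
      fun y hy => (hy : AnalyticAt ℂ φ y).differentiableAt.differentiableWithinAt
    have := (Complex.differentiableOn_dslope (hopen.mem_nhds hxU)).2 hd
    exact this.differentiableAt (hopen.mem_nhds (hφR z h1 h2 h3))
  set s : ℂ := ((Real.sqrt q : ℝ) : ℂ) with hsdef
  -- The integrand is $dz/z$ times a function odd under $z\mapsto z^{-1}$. Inversion exchanges radii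
  -- $R$ and $R^{-1}$, which give equal integrals by holomorphy on the annulus, so the integral
  -- equals its own negative.
  have hzero : (∮ z in C(0, R), z⁻¹ • (s * (z - z⁻¹) * ψ (joukowski q z))) = 0 := by
    have h1 := circleIntegral_eq_circleIntegral_inv hR1.le
      (g := fun z => s * (z - z⁻¹) * ψ (joukowski q z)) (fun z h1 h2 h3 =>
        ((differentiableAt_id.sub (differentiableAt_inv h3)).const_mul s).mul
          ((hψd z h1 h2 h3).comp z (differentiableAt_joukowski q h3)))
      ((inv_le_one_of_one_le₀ hR1.le).trans hR1.le) le_rfl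
    have h2 := circleIntegral_inv_smul_comp_inv hR0.ne'
      (fun z => s * (z - z⁻¹) * ψ (joukowski q z))
    have h3 : (∮ z in C(0, R⁻¹), z⁻¹ • (s * (z⁻¹ - z⁻¹⁻¹) * ψ (joukowski q z⁻¹))) =
        -∮ z in C(0, R⁻¹), z⁻¹ • (s * (z - z⁻¹) * ψ (joukowski q z)) := by
      rw [← neg_one_mul, ← circleIntegral.integral_const_mul]
      refine congrArg (fun f => circleIntegral f 0 R⁻¹) (funext fun z => ?_)
      rw [joukowski_inv, inv_inv, smul_eq_mul, smul_eq_mul]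
      ring
    rw [h3, ← h1] at h2
    exact self_eq_neg.1 h2.symm
  have hne : ∀ v : ℂ, ‖v‖ < R → ∀ z ∈ Metric.sphere (0 : ℂ) R, z - v ≠ 0 := by
    intro v hv z hz h
    rw [sub_eq_zero.1 h, mem_sphere_zero_iff_norm] at hz
    exact hv.ne hz
  have hci : ∀ v : ℂ, ‖v‖ < R → ∀ g : ℂ → ℂ, ContinuousOn g (Metric.sphere 0 R) →
      CircleIntegrable (fun z => (z - v)⁻¹ • g z) 0 R := by
    intro v hv g hg
    refine ContinuousOn.circleIntegrable hR0.le ?_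
    exact ((continuousOn_id.sub continuousOn_const).inv₀ (hne v hv)).smul hg
  have hint : ∀ v : ℂ, ‖v‖ < R → (∮ z in C(0, R), (z - v)⁻¹ • φ x) = 2 * Real.pi * I * φ x := by
    intro v hv
    rw [circleIntegral.integral_smul_const,
      circleIntegral.integral_sub_inv_of_mem_ball (by simpa using hv), smul_eq_mul]
  have h0R : ‖(0 : ℂ)‖ < R := by simpa using hR0
  have hψc : ContinuousOn (fun z => s * (z - z⁻¹) * ψ (joukowski q z)) (Metric.sphere 0 R) := by
    intro z hz
    obtain ⟨h1, h2, h3⟩ := hRc z hz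
    exact (((differentiableAt_id.sub (differentiableAt_inv h3)).const_mul s).mul
      ((hψd z h1 h2 h3).comp z (differentiableAt_joukowski q h3))).continuousAt.continuousWithinAt
  have hmain : (∮ z in C(0, R), (z - w)⁻¹ • F z) + (∮ z in C(0, R), (z - w⁻¹)⁻¹ • F z) =
      2 * Real.pi * I * φ x + ∮ z in C(0, R), (z - 0)⁻¹ • F z := by
    have hcongr : (∮ z in C(0, R), ((z - w)⁻¹ • F z + (z - w⁻¹)⁻¹ • F z - (z - 0)⁻¹ • F z)) =
        ∮ z in C(0, R), ((z - w)⁻¹ • φ x + (z - w⁻¹)⁻¹ • φ x - (z - 0)⁻¹ • φ x +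
          (z - 0)⁻¹ • (s * (z - z⁻¹) * ψ (joukowski q z))) := by
      refine circleIntegral.integral_congr hR0.le fun z hz => ?_
      have h1 := hne w hwR z hz
      have h2 := hne w⁻¹ hwR' z hz
      have h3 := (hRc z hz).2.2
      have h4 : F z = φ x + (joukowski q z - x) * ψ (joukowski q z) := by
        have := sub_smul_dslope φ x (joukowski q z)
        rw [smul_eq_mul] at this
        rw [hψ, this, hF]; ring
      -- Subtracting $z^{-1}$ makes this product exactly the odd kernel of `hzero`; it also accounts
      -- for the extra $c_0$ in the sum.
      have h5 : ((z - w)⁻¹ + (z - w⁻¹)⁻¹ - z⁻¹) * (joukowski q z - x) = z⁻¹ * (s * (z - z⁻¹)) := by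
        have h6 : joukowski q z - x = s * ((z - w) * (z - w⁻¹) * z⁻¹) := by
          rw [hx, joukowski, joukowski]
          field_simp
          ring
        have h7 : ((z - w)⁻¹ + (z - w⁻¹)⁻¹ - z⁻¹) * ((z - w) * (z - w⁻¹)) = z - z⁻¹ := by
          have e1 : (z - w)⁻¹ * (z - w) = 1 := inv_mul_cancel₀ h1
          have e2 : (z - w⁻¹)⁻¹ * (z - w⁻¹) = 1 := inv_mul_cancel₀ h2
          have e3 : z⁻¹ * z = 1 := inv_mul_cancel₀ h3
          have e4 : w * w⁻¹ = 1 := mul_inv_cancel₀ hw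
          linear_combination (z - w⁻¹) * e1 + (z - w) * e2 - (z - w - w⁻¹) * e3 - z⁻¹ * e4
        rw [h6]
        linear_combination s * z⁻¹ * h7
      simp only [smul_eq_mul, sub_zero]
      rw [h4]
      linear_combination ψ (joukowski q z) * h5
    have i1 := hci w hwR F hFc
    have i2 := hci w⁻¹ hwR' F hFc
    have i3 := hci 0 h0R F hFc
    have j1 := hci w hwR (fun _ => φ x) continuousOn_const
    have j2 := hci w⁻¹ hwR' (fun _ => φ x) continuousOn_const
    have j3 := hci 0 h0R (fun _ => φ x) continuousOn_const
    have j4 := hci 0 h0R _ hψc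
    have i12 : CircleIntegrable (fun z => (z - w)⁻¹ • F z + (z - w⁻¹)⁻¹ • F z) 0 R := i1.add i2
    have j12 : CircleIntegrable (fun z => (z - w)⁻¹ • φ x + (z - w⁻¹)⁻¹ • φ x) 0 R := j1.add j2
    have j123 : CircleIntegrable
      (fun z => (z - w)⁻¹ • φ x + (z - w⁻¹)⁻¹ • φ x - (z - 0)⁻¹ • φ x) 0 R := j12.sub j3
    rw [circleIntegral.integral_sub i12 i3, circleIntegral.integral_add i1 i2,
      circleIntegral.integral_add j123 j4, circleIntegral.integral_sub j12 j3,
      circleIntegral.integral_add j1 j2, hint w hwR, hint _ hwR', hint 0 h0R] at hcongr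
    simp only [sub_zero] at hcongr ⊢
    rw [hzero] at hcongr
    linear_combination hcongr
  have h0 := hcoef 0
  simp only [pow_zero, mul_one] at h0
  have htot := ((hsum w hwR).add (hsum w⁻¹ hwR')).mul_left (2 * Real.pi * I : ℂ)⁻¹
  rw [hmain] at htot
  simp only [sub_zero] at htot
  rw [h0, ← mul_add, inv_mul_cancel_left₀ hpi] at htot
  refine htot.congr_fun fun n => ?_
  field_simp

end CosineExpansion
-- The substitution $s=c\cos\theta$
section CosineSubstitution

open Set

theorem image_mul_cos_Ioo {c : ℝ} (hc : 0 < c) :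
    (fun θ => c * Real.cos θ) '' Ioo 0 Real.pi = Ioo (-c) c := by
  ext s
  constructor
  · rintro ⟨θ, ⟨h0, h1⟩, rfl⟩
    have e1 : Real.cos θ < 1 := by
      rw [← Real.cos_zero]; exact Real.cos_lt_cos_of_nonneg_of_le_pi le_rfl h1.le h0
    have e2 : -1 < Real.cos θ := by
      rw [← Real.cos_pi]; exact Real.cos_lt_cos_of_nonneg_of_le_pi h0.le le_rfl h1
    constructor <;> simp only <;> nlinarith
  · rintro ⟨h0, h1⟩
    have e1 : -1 < s / c := by rw [lt_div_iff₀ hc]; linarith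
    have e2 : s / c < 1 := by rw [div_lt_iff₀ hc]; linarith
    refine ⟨Real.arccos (s / c), ⟨Real.arccos_pos.2 e2, Real.arccos_lt_pi.2 e1⟩, ?_⟩
    simp only
    rw [Real.cos_arccos e1.le e2.le, mul_div_cancel₀ _ hc.ne']

theorem integrable_and_integral_eq_of_cos {c : ℝ} (hc : 0 < c) {k K : ℝ → ℂ}
    (hk : ∀ s, s ∉ Ioo (-c) c → k s = 0) (hK : IntegrableOn K (Ioo 0 Real.pi))
    (h : ∀ θ ∈ Ioo 0 Real.pi, ((c * Real.sin θ : ℝ) : ℂ) * k (c * Real.cos θ) = K θ) :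
    Integrable k ∧ ∫ s, k s = ∫ θ in (0 : ℝ)..Real.pi, K θ := by
  have hderiv : ∀ θ ∈ Ioo 0 Real.pi, HasDerivWithinAt (fun θ => c * Real.cos θ)
      (c * -Real.sin θ) (Ioo 0 Real.pi) θ := fun θ _ =>
    ((Real.hasDerivAt_cos θ).const_mul c).hasDerivWithinAt
  have hinj : InjOn (fun θ => c * Real.cos θ) (Ioo 0 Real.pi) := by
    intro a ha b hb hab
    exact Real.injOn_cos (Ioo_subset_Icc_self ha) (Ioo_subset_Icc_self hb)
      (mul_left_cancel₀ hc.ne' hab)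
  have hEq : EqOn (fun θ => |c * -Real.sin θ| • k (c * Real.cos θ)) K (Ioo 0 Real.pi) := by
    intro θ hθ
    have : 0 < Real.sin θ := Real.sin_pos_of_mem_Ioo hθ
    simp only
    rw [mul_neg, abs_neg, abs_of_nonneg (by positivity), Complex.real_smul, h θ hθ]
  have hsupp : Function.support k ⊆ Ioo (-c) c := fun s hs => by
    by_contra h'; exact hs (hk s h')
  constructor
  · rw [← integrableOn_iff_integrable_of_support_subset hsupp, ← image_mul_cos_Ioo hc,
      integrableOn_image_iff_integrableOn_abs_deriv_smul measurableSet_Ioo hderiv hinj]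
    exact hK.congr_fun hEq.symm measurableSet_Ioo
  · rw [← setIntegral_eq_integral_of_forall_compl_eq_zero (s := Ioo (-c) c) (fun s hs => hk s hs),
      ← image_mul_cos_Ioo hc,
      integral_image_eq_integral_abs_deriv_smul measurableSet_Ioo hderiv hinj,
      setIntegral_congr_fun measurableSet_Ioo hEq,
      intervalIntegral.integral_of_le Real.pi_pos.le, integral_Ioc_eq_integral_Ioo]

end CosineSubstitution

/-! ### Pairings of the two densities with a test function -/

section Densities

open Set

variable {q : ℕ} {φ : ℂ → ℂ}

/-- Makes both densities vanish off the open interval. At the endpoints, where `unitStep` is $1$,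
the geodesic density is $0$ because division by zero gives $0$. -/
theorem sqrt_eq_zero_of_notMem {s : ℝ} (hs : s ∉ Ioo (-(2 * Real.sqrt q)) (2 * Real.sqrt q)) :
    Real.sqrt (4 * q - s ^ 2) = 0 := by
  have hs2 : Real.sqrt q * Real.sqrt q = q := Real.mul_self_sqrt (by positivity)
  have := Real.sqrt_nonneg (q : ℝ)
  refine Real.sqrt_eq_zero_of_nonpos ?_
  rw [mem_Ioo, ← abs_lt, not_lt] at hs
  have := mul_self_le_mul_self (by positivity) hs
  rw [abs_mul_abs_self] at this
  nlinarith

theorem four_mul_sub_sq (q : ℕ) (θ : ℝ) :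
    4 * (q : ℝ) - (2 * Real.sqrt q * Real.cos θ) ^ 2 = (2 * Real.sqrt q * Real.sin θ) ^ 2 := by
  have hs2 : Real.sqrt q * Real.sqrt q = q := Real.mul_self_sqrt (by positivity)
  have := Real.sin_sq_add_cos_sq θ
  linear_combination (4 * Real.cos θ ^ 2 + 4 * Real.sin θ ^ 2) * -hs2 - 4 * (q : ℝ) * this

theorem sqrt_four_mul_sub_sq (q : ℕ) {θ : ℝ} (hθ : θ ∈ Ioo 0 Real.pi) :
    Real.sqrt (4 * (q : ℝ) - (2 * Real.sqrt q * Real.cos θ) ^ 2) =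
      2 * Real.sqrt q * Real.sin θ := by
  have := Real.sin_pos_of_mem_Ioo hθ
  rw [four_mul_sub_sq, Real.sqrt_sq (by positivity)]

theorem unitStep_four_mul_sub_sq (q : ℕ) (θ : ℝ) :
    unitStep (4 * (q : ℝ) - (2 * Real.sqrt q * Real.cos θ) ^ 2) = 1 := by
  rw [four_mul_sub_sq, unitStep, if_pos (sq_nonneg _)]

/-- The Jacobian $2\sqrt q\sin\theta$ cancels the square root in the denominator, and
$T_n(\cos\theta)=\cos n\theta$. -/
theorem geodesicDensity_pairing (hq : 1 ≤ q) (hφ : IsTestFunction q φ) {V : Type*}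
    {G : SimpleGraph V} (γ : LongGeodesic G) :
    Integrable (fun s : ℝ => (geodesicDensity q γ s : ℂ) * φ (s : ℂ)) ∧
      pairing (geodesicDensity q γ) φ = (γ.1.primitiveLength : ℂ) *
        ((((q : ℝ) ^ (-(γ.1.length : ℝ) / 2) : ℝ) : ℂ) * cosCoeff q φ γ.1.length) := by
  have hs : 0 < Real.sqrt q := Real.sqrt_pos.2 (by exact_mod_cast hq)
  have hc := hφ.continuous_comp_cos
  have := integrable_and_integral_eq_of_cos (c := 2 * Real.sqrt q) (by positivity)
    (k := fun s : ℝ => (geodesicDensity q γ s : ℂ) * φ (s : ℂ))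
    (K := fun θ : ℝ => ((γ.1.primitiveLength : ℂ) *
      (((q : ℝ) ^ (-(γ.1.length : ℝ) / 2) : ℝ) : ℂ) * (Real.pi : ℂ)⁻¹) *
        (φ ((2 * Real.sqrt q * Real.cos θ : ℝ) : ℂ) * (Real.cos (γ.1.length * θ) : ℂ)))
    (fun s hs => by
      simp only [geodesicDensity, sqrt_eq_zero_of_notMem hs, mul_zero, div_zero, zero_mul,
        Complex.ofReal_zero])
    (by
      refine (Continuous.integrableOn_Icc (a := 0) (b := Real.pi) ?_).mono_set Ioo_subset_Icc_self
      exact continuous_const.mul (hc.mul (by fun_prop)))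
    (fun θ hθ => by
      have hsin := Real.sin_pos_of_mem_Ioo hθ
      have hT : (Polynomial.Chebyshev.T ℝ (γ.1.length : ℤ)).eval
          (2 * Real.sqrt q * Real.cos θ / (2 * Real.sqrt q)) = Real.cos (γ.1.length * θ) := by
        rw [mul_div_cancel_left₀ _ (by positivity), Polynomial.Chebyshev.T_real_cos]
        simp
      have e : (2 * Real.sqrt q * Real.sin θ) * geodesicDensity q γ (2 * Real.sqrt q * Real.cos θ) =
          γ.1.primitiveLength * (q : ℝ) ^ (-(γ.1.length : ℝ) / 2) * Real.pi⁻¹ *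
            Real.cos (γ.1.length * θ) := by
        rw [geodesicDensity, hT, sqrt_four_mul_sub_sq q hθ, unitStep_four_mul_sub_sq]
        field_simp
      have e' := congrArg (fun x : ℝ => (x : ℂ)) e
      simp only [Complex.ofReal_mul (_ * _) (geodesicDensity _ _ _)] at e'
      rw [← mul_assoc, e']
      push_cast
      ring)
  refine ⟨this.1, ?_⟩
  rw [pairing, this.2, intervalIntegral.integral_const_mul, cosCoeff]
  ring

/-- The contractible density, up to the number of vertices, after substituting `2 √q cos θ`. -/
noncomputable def contractibleKernel (q : ℕ) (θ : ℝ) : ℝ :=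
  ((q : ℝ) + 1) / 2 * (4 * q * Real.sin θ ^ 2 / (((q : ℝ) + 1) ^ 2 - 4 * q * Real.cos θ ^ 2))

/-- The denominator exceeds the numerator $4q\sin^2\theta$ by $(q-1)^2$, so the quotient lies in
$[0,1]$. -/
theorem norm_contractibleKernel_le (q : ℕ) (θ : ℝ) :
    ‖contractibleKernel q θ‖ ≤ ((q : ℝ) + 1) / 2 := by
  have h1 : 4 * (q : ℝ) * Real.sin θ ^ 2 ≤ ((q : ℝ) + 1) ^ 2 - 4 * q * Real.cos θ ^ 2 := by
    have := Real.sin_sq_add_cos_sq θ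
    have e : 4 * (q : ℝ) * Real.sin θ ^ 2 = 4 * q - 4 * q * Real.cos θ ^ 2 := by
      linear_combination 4 * (q : ℝ) * this
    nlinarith [sq_nonneg ((q : ℝ) - 1)]
  have h2 : 0 ≤ 4 * (q : ℝ) * Real.sin θ ^ 2 := by positivity
  have h3 := h2.trans h1
  have h4 := div_le_one_of_le₀ h1 h3
  have h5 := div_nonneg h2 h3
  rw [contractibleKernel, Real.norm_eq_abs, abs_of_nonneg (by positivity)]
  exact mul_le_of_le_one_right (by positivity) h4

theorem integrableOn_contractibleKernel_mul (hφ : IsTestFunction q φ) :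
    IntegrableOn (fun θ : ℝ => (contractibleKernel q θ : ℂ) *
      φ ((2 * Real.sqrt q * Real.cos θ : ℝ) : ℂ)) (Icc 0 Real.pi) := by
  refine Integrable.bdd_mul (c := ((q : ℝ) + 1) / 2)
    (hφ.continuous_comp_cos.integrableOn_Icc (a := 0) (b := Real.pi)) ?_ ?_
  · refine Measurable.aestronglyMeasurable ?_
    unfold contractibleKernel
    fun_prop
  · refine Filter.Eventually.of_forall fun θ => ?_
    rw [Complex.norm_real]
    exact norm_contractibleKernel_le q θ

theorem contractibleDensity_pairing (hq : 1 ≤ q) (hφ : IsTestFunction q φ) (n : ℕ) :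
    Integrable (fun s : ℝ => (contractibleDensity n q s : ℂ) * φ (s : ℂ)) ∧
      pairing (contractibleDensity n q) φ = (n : ℂ) * ((Real.pi : ℂ)⁻¹ *
        ∫ θ in (0 : ℝ)..Real.pi, (contractibleKernel q θ : ℂ) *
          φ ((2 * Real.sqrt q * Real.cos θ : ℝ) : ℂ)) := by
  have hs : 0 < Real.sqrt q := Real.sqrt_pos.2 (by exact_mod_cast hq)
  have hs2 : Real.sqrt q * Real.sqrt q = q := Real.mul_self_sqrt (by positivity)
  have := integrable_and_integral_eq_of_cos (c := 2 * Real.sqrt q) (by positivity)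
    (k := fun s : ℝ => (contractibleDensity n q s : ℂ) * φ (s : ℂ))
    (K := fun θ : ℝ => ((n : ℂ) * (Real.pi : ℂ)⁻¹) * ((contractibleKernel q θ : ℂ) *
      φ ((2 * Real.sqrt q * Real.cos θ : ℝ) : ℂ)))
    (fun s hs => by
      simp only [contractibleDensity, sqrt_eq_zero_of_notMem hs, mul_zero, zero_div, zero_mul,
        Complex.ofReal_zero])
    (((integrableOn_contractibleKernel_mul hφ).mono_set Ioo_subset_Icc_self).const_mul _)
    (fun θ hθ => by
      have e : (2 * Real.sqrt q * Real.sin θ) *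
          contractibleDensity n q (2 * Real.sqrt q * Real.cos θ) =
          n * Real.pi⁻¹ * contractibleKernel q θ := by
        have e1 : (2 * Real.sqrt q * Real.cos θ) ^ 2 = 4 * q * Real.cos θ ^ 2 := by
          linear_combination 4 * Real.cos θ ^ 2 * hs2
        have e2 : 4 * q * Real.sin θ ^ 2 = (2 * Real.sqrt q * Real.sin θ) ^ 2 := by
          linear_combination -4 * Real.sin θ ^ 2 * hs2
        rw [contractibleDensity, sqrt_four_mul_sub_sq q hθ, unitStep_four_mul_sub_sq,
          contractibleKernel, e1, e2]
        ring
      have e' := congrArg (fun x : ℝ => (x : ℂ)) e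
      simp only [Complex.ofReal_mul (_ * _) (contractibleDensity _ _ _)] at e'
      rw [← mul_assoc, e']
      push_cast
      ring)
  refine ⟨this.1, ?_⟩
  rw [pairing, this.2, intervalIntegral.integral_const_mul]
  ring

/-- With $y=e^{i\theta}$ and $t=q^{-1/2}$, only even $n$ survive, leaving geometric series in
$(ty)^2$ and $(ty^{-1})^2$. -/
theorem hasSum_cos_kernel (hq : 1 ≤ q) {θ : ℝ} (hθ : Real.sin θ ≠ 0) :
    HasSum (fun n : ℕ => ((q : ℂ) - 1) / 2 * (1 + (-1) ^ n) * (((Real.sqrt q)⁻¹ : ℝ) : ℂ) ^ n *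
      (Real.cos (n * θ) : ℂ)) ((q : ℂ) - (contractibleKernel q θ : ℂ)) := by
  have hsc := Real.sin_sq_add_cos_sq θ
  -- For $q=1$ the geometric ratio has modulus $1$, but the prefactor $q-1$ kills every term, and
  -- the kernel is $1$ where $\sin\theta\ne0$.
  rcases hq.eq_or_lt with rfl | hq
  · have : contractibleKernel 1 θ = 1 := by
      have e : ((1 : ℝ) + 1) ^ 2 - 4 * 1 * Real.cos θ ^ 2 = 4 * 1 * Real.sin θ ^ 2 := by
        linear_combination -4 * hsc
      rw [contractibleKernel, Nat.cast_one, e, div_self (by positivity)]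
      norm_num
    rw [this]
    simp [hasSum_zero]
  have hq0 : (0 : ℝ) < q := by positivity
  have hs2 : Real.sqrt q * Real.sqrt q = q := Real.mul_self_sqrt (by positivity)
  have hs1 : 1 < Real.sqrt q := by rw [Real.lt_sqrt zero_le_one]; simpa using hq
  set t : ℂ := (((Real.sqrt q)⁻¹ : ℝ) : ℂ) with ht
  have htn : ‖t‖ < 1 := by
    rw [ht, Complex.norm_real, Real.norm_eq_abs, abs_of_pos (by positivity)]
    exact inv_lt_one_of_one_lt₀ hs1
  have ht2 : (q : ℂ) * t ^ 2 = 1 := by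
    have : (q : ℝ) * ((Real.sqrt q)⁻¹) ^ 2 = 1 := by
      rw [inv_pow, sq, hs2, mul_inv_cancel₀ hq0.ne']
    rw [ht]
    exact_mod_cast this
  set y : ℂ := Complex.exp (θ * Complex.I) with hy
  have hyn : ‖y‖ = 1 := Complex.norm_exp_ofReal_mul_I θ
  have hy0 : y ≠ 0 := Complex.exp_ne_zero _
  have hyc : y + y⁻¹ = 2 * (Real.cos θ : ℂ) := by
    rw [hy, ← Complex.exp_neg, Complex.ofReal_cos, Complex.cos, ← neg_mul]; ring
  have hyc2 : y ^ 2 + y⁻¹ ^ 2 = 4 * (Real.cos θ : ℂ) ^ 2 - 2 := by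
    have : y * y⁻¹ = 1 := mul_inv_cancel₀ hy0
    linear_combination (y + y⁻¹ + 2 * (Real.cos θ : ℂ)) * hyc - 2 * this
  have hpair : ∀ x : ℂ, ‖x‖ < 1 →
      HasSum (fun n : ℕ => (1 + (-1) ^ n) * x ^ n) (2 / (1 - x ^ 2)) := by
    intro x hx
    have h1 : 1 - x ≠ 0 := fun h => by rw [← sub_eq_zero.1 h] at hx; simp at hx
    have h2 : 1 + x ≠ 0 := fun h => by
      rw [← sub_neg_eq_add] at h
      have : ‖-x‖ = 1 := by rw [← sub_eq_zero.1 h]; simp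
      rw [norm_neg] at this
      exact hx.ne this
    have := (hasSum_geometric_of_norm_lt_one hx).add
      (hasSum_geometric_of_norm_lt_one (ξ := -x) (by rwa [norm_neg]))
    have e : (1 - x)⁻¹ + (1 - -x)⁻¹ = 2 / (1 - x ^ 2) := by
      rw [show 1 - x ^ 2 = (1 - x) * (1 + x) by ring, sub_neg_eq_add]
      field_simp
      ring
    rw [e] at this
    refine this.congr_fun fun n => ?_
    rw [neg_pow x n]; ring
  have n1 : ‖t * y‖ < 1 := by rwa [norm_mul, hyn, mul_one]
  have n2 : ‖t * y⁻¹‖ < 1 := by rwa [norm_mul, norm_inv, hyn, inv_one, mul_one]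
  have h := ((hpair _ n1).add (hpair _ n2)).mul_left (((q : ℂ) - 1) / 4)
  have hne : ∀ x : ℂ, ‖x‖ < 1 → 1 - x ^ 2 ≠ 0 := by
    intro x hx h
    have h1 : ‖x ^ 2‖ = 1 := by rw [← sub_eq_zero.1 h]; simp
    rw [norm_pow] at h1
    nlinarith [norm_nonneg x]
  have hval : ((q : ℂ) - 1) / 4 * (2 / (1 - (t * y) ^ 2) + 2 / (1 - (t * y⁻¹) ^ 2)) =
      (q : ℂ) - (contractibleKernel q θ : ℂ) := by
    have a1 := hne _ n1
    have a2 := hne _ n2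
    have hq0' : (q : ℂ) ≠ 0 := by exact_mod_cast hq0.ne'
    have hyy : y * y⁻¹ = 1 := mul_inv_cancel₀ hy0
    have hsum : (1 - (t * y) ^ 2) + (1 - (t * y⁻¹) ^ 2) =
        2 - t ^ 2 * (4 * (Real.cos θ : ℂ) ^ 2 - 2) := by
      linear_combination -t ^ 2 * hyc2
    have hprod : (1 - (t * y) ^ 2) * (1 - (t * y⁻¹) ^ 2) =
        1 - t ^ 2 * (4 * (Real.cos θ : ℂ) ^ 2 - 2) + t ^ 4 := by
      linear_combination -t ^ 2 * hyc2 + t ^ 4 * (y * y⁻¹ + 1) * hyy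
    have hD : ((q : ℂ) + 1) ^ 2 - 4 * q * (Real.cos θ : ℂ) ^ 2 =
        q ^ 2 * ((1 - (t * y) ^ 2) * (1 - (t * y⁻¹) ^ 2)) := by
      rw [hprod]
      linear_combination (q * (4 * (Real.cos θ : ℂ) ^ 2 - 2) - (q * t ^ 2 + 1)) * ht2
    have hD0 : ((q : ℂ) + 1) ^ 2 - 4 * q * (Real.cos θ : ℂ) ^ 2 ≠ 0 := by
      rw [hD]; exact mul_ne_zero (pow_ne_zero _ hq0') (mul_ne_zero a1 a2)
    have hsc' : (Real.sin θ : ℂ) ^ 2 = 1 - (Real.cos θ : ℂ) ^ 2 := by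
      rw [eq_sub_iff_add_eq]; exact_mod_cast hsc
    have lhs : ((q : ℂ) - 1) / 4 * (2 / (1 - (t * y) ^ 2) + 2 / (1 - (t * y⁻¹) ^ 2)) =
        ((q : ℂ) - 1) / 2 * (q ^ 2 * ((1 - (t * y) ^ 2) + (1 - (t * y⁻¹) ^ 2))) /
          (((q : ℂ) + 1) ^ 2 - 4 * q * (Real.cos θ : ℂ) ^ 2) := by
      have gen : ∀ A B : ℂ, A ≠ 0 → B ≠ 0 → ((q : ℂ) - 1) / 4 * (2 / A + 2 / B) =
          ((q : ℂ) - 1) / 2 * (q ^ 2 * (A + B)) / (q ^ 2 * (A * B)) := by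
        intro A B hA hB
        field_simp
        ring
      rw [hD, gen _ _ a1 a2]
    rw [lhs, hsum, contractibleKernel]
    push_cast only [Complex.ofReal_mul, Complex.ofReal_div, Complex.ofReal_sub, Complex.ofReal_add,
      Complex.ofReal_pow, Complex.ofReal_natCast, Complex.ofReal_one, Complex.ofReal_ofNat]
    rw [hsc']
    rw [div_eq_iff hD0, sub_mul, mul_assoc ((_ + 1) / 2), div_mul_cancel₀ _ hD0]
    linear_combination -((q : ℂ) - 1) / 2 * q * (4 * (Real.cos θ : ℂ) ^ 2 - 2) * ht2
  rw [hval] at h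
  refine h.congr_fun fun n => ?_
  have hcos : ((Real.cos (n * θ) : ℝ) : ℂ) = (y ^ n + y⁻¹ ^ n) / 2 := by
    rw [hy, ← Complex.exp_neg, ← Complex.exp_nat_mul, ← Complex.exp_nat_mul, Complex.ofReal_cos,
      Complex.cos]
    push_cast
    ring_nf
  rw [hcos, mul_pow, mul_pow]
  ring

theorem hasSum_parity_cosCoeff (hq : 1 ≤ q) (hφ : IsTestFunction q φ) :
    HasSum (fun n : ℕ => ((q : ℂ) - 1) / 2 * (1 + (-1) ^ n) * (((Real.sqrt q)⁻¹ : ℝ) : ℂ) ^ n *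
      cosCoeff q φ n) ((q : ℂ) * cosCoeff q φ 0 - (Real.pi : ℂ)⁻¹ *
        ∫ θ in (0 : ℝ)..Real.pi, (contractibleKernel q θ : ℂ) *
          φ ((2 * Real.sqrt q * Real.cos θ : ℝ) : ℂ)) := by
  have hc := hφ.continuous_comp_cos
  set f : ℝ → ℂ := fun θ => φ ((2 * Real.sqrt q * Real.cos θ : ℝ) : ℂ) with hf
  set a : ℕ → ℂ := fun n => ((q : ℂ) - 1) / 2 * (1 + (-1) ^ n) * (((Real.sqrt q)⁻¹ : ℝ) : ℂ) ^ n
    with ha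
  have hasum : Summable fun n => ‖a n‖ := by
    rcases hq.eq_or_lt with rfl | hq
    · simp [ha, summable_zero]
    have hs1 : 1 < Real.sqrt q := by rw [Real.lt_sqrt zero_le_one]; simpa using hq
    refine Summable.of_nonneg_of_le (fun _ => norm_nonneg _) (fun n => ?_)
      ((summable_geometric_of_lt_one (r := (Real.sqrt q)⁻¹) (by positivity)
        (inv_lt_one_of_one_lt₀ hs1)).mul_left (‖((q : ℂ) - 1) / 2‖ * 2))
    simp only [ha]
    rw [norm_mul, norm_mul, norm_pow, Complex.norm_real, Real.norm_eq_abs,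
      abs_of_nonneg (by positivity)]
    gcongr
    refine (norm_add_le _ _).trans ?_
    rw [norm_pow, norm_neg, norm_one, one_pow]
    norm_num
  have key := intervalIntegral.hasSum_integral_of_dominated_convergence (μ := volume) (a := 0)
    (b := Real.pi) (F := fun (n : ℕ) θ => a n * (f θ * (Real.cos (n * θ) : ℂ)))
    (f := fun θ => ((q : ℂ) - (contractibleKernel q θ : ℂ)) * f θ)
    (fun n θ => ‖a n‖ * ‖f θ‖)
    (fun n => (continuous_const.mul (hc.mul (by fun_prop))).aestronglyMeasurable)
    (fun n => Filter.Eventually.of_forall fun θ _ => by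
      rw [norm_mul (a n), norm_mul (f θ), Complex.norm_real]
      exact mul_le_mul_of_nonneg_left
        (mul_le_of_le_one_right (norm_nonneg _) (Real.abs_cos_le_one _)) (norm_nonneg _))
    (Filter.Eventually.of_forall fun θ _ => hasum.mul_right _)
    (by
      simp only [tsum_mul_right]
      exact (continuous_const.mul hc.norm).intervalIntegrable _ _)
    (by
      -- The pointwise sum needs $\sin\theta\ne0$; on $(0,\pi]$ only the endpoint has to be
      -- discarded.
      have hne : ∀ᵐ θ : ℝ, θ ≠ Real.pi := Measure.ae_ne volume Real.pi
      filter_upwards [hne] with θ hθ hmem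
      rw [uIoc_of_le Real.pi_pos.le] at hmem
      have hsin := Real.sin_pos_of_mem_Ioo ⟨hmem.1, lt_of_le_of_ne hmem.2 hθ⟩
      refine ((hasSum_cos_kernel hq hsin.ne').mul_right (f θ)).congr_fun fun n => ?_
      simp only [ha]
      ring)
  have hki : IntervalIntegrable (fun θ : ℝ => (contractibleKernel q θ : ℂ) * f θ) volume 0 Real.pi :=
    (intervalIntegrable_iff_integrableOn_Icc_of_le Real.pi_pos.le).2
      (integrableOn_contractibleKernel_mul hφ)
  have hc0 : cosCoeff q φ 0 = (Real.pi : ℂ)⁻¹ * ∫ θ in (0 : ℝ)..Real.pi, f θ := by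
    simp [cosCoeff, hf]
  have hval : (Real.pi : ℂ)⁻¹ * ∫ θ in (0 : ℝ)..Real.pi,
      ((q : ℂ) - (contractibleKernel q θ : ℂ)) * f θ = (q : ℂ) * cosCoeff q φ 0 - (Real.pi : ℂ)⁻¹ *
        ∫ θ in (0 : ℝ)..Real.pi, (contractibleKernel q θ : ℂ) * f θ := by
    have hfi : IntervalIntegrable (fun θ : ℝ => (q : ℂ) * f θ) volume 0 Real.pi :=
      (continuous_const.mul hc).intervalIntegrable _ _
    simp only [sub_mul]
    rw [intervalIntegral.integral_sub hfi hki,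
      intervalIntegral.integral_const_mul, hc0]
    ring
  rw [← hval]
  refine (key.mul_left _).congr_fun fun n => ?_
  rw [intervalIntegral.integral_const_mul, cosCoeff]
  ring

end Densities
-- Assembly of the trace formula
theorem rpow_neg_div_two (q n : ℕ) :
    (q : ℝ) ^ (-(n : ℝ) / 2) = (Real.sqrt q)⁻¹ ^ n := by
  rw [neg_div, Real.rpow_neg (Nat.cast_nonneg q), Real.sqrt_eq_rpow, inv_pow, ← Real.rpow_natCast,
    ← Real.rpow_mul (Nat.cast_nonneg q)]
  congr 2
  ring

theorem hasSum_loopCount_mul_cosCoeff {V : Type*} [Fintype V] [DecidableEq V] {G : SimpleGraph V}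
    [DecidableRel G.Adj] {q : ℕ} (hq : 1 ≤ q) (hreg : G.IsRegularOfDegree (q + 1)) {φ : ℂ → ℂ}
    (hφ : IsTestFunction q φ) :
    HasSum (fun n : ℕ => (loopCount G n : ℂ) *
        ((((q : ℝ) ^ (-(n : ℝ) / 2) : ℝ) : ℂ) * cosCoeff q φ n))
      (∑ v, φ (graphEigenvalues G v : ℂ) - (Fintype.card V : ℂ) * ((Real.pi : ℂ)⁻¹ *
        ∫ θ in (0 : ℝ)..Real.pi, (contractibleKernel q θ : ℂ) *
          φ ((2 * Real.sqrt q * Real.cos θ : ℝ) : ℂ))) := by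
  have hs : Real.sqrt q ≠ 0 := (Real.sqrt_pos.2 (by exact_mod_cast hq)).ne'
  have hs2 : Real.sqrt q * Real.sqrt q = q := Real.mul_self_sqrt (by positivity)
  set s : ℂ := ((Real.sqrt q : ℝ) : ℂ) with hsdef
  have hs0 : s ≠ 0 := by rw [hsdef]; exact_mod_cast hs
  have hss : s * s = q := by rw [hsdef]; exact_mod_cast hs2
  choose w hw0 hw using fun v => exists_joukowski_eq hq (graphEigenvalues G v : ℂ)
  have h1 : ∀ v, HasSum (fun n => (w v ^ n + (w v)⁻¹ ^ n) * cosCoeff q φ n)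
      (φ (graphEigenvalues G v : ℂ) + cosCoeff q φ 0) := by
    intro v
    rw [← hw v]
    refine hφ.hasSum_cosCoeff hq (hw0 v) ?_
    rw [hw v]
    refine ofReal_mem_ellipticRegion ?_
    exact_mod_cast abs_graphEigenvalues_le hreg v
  have h2 := (hasSum_sum fun v (_ : v ∈ Finset.univ) => h1 v).add
    ((hasSum_parity_cosCoeff hq hφ).mul_left (Fintype.card V : ℂ))
  -- The terms at $n=0$ are removed: $2c_0$ per eigenvalue and $(q-1)c_0$ per vertex, which cancel
  -- the $c_0$ and $qc_0$ in the two totals.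
  rw [← hasSum_nat_add_iff' 1] at h2 ⊢
  simp only [Finset.sum_range_one, loopCount_zero] at h2 ⊢
  rw [Nat.cast_zero, zero_mul, sub_zero]
  convert h2 using 1
  · funext n
    rw [loopCount_eq hreg, rpow_neg_div_two]
    have e : ∀ v, (Polynomial.dickson 1 (q : ℂ) (n + 1)).eval (graphEigenvalues G v : ℂ) =
        s ^ (n + 1) * (w v ^ (n + 1) + (w v)⁻¹ ^ (n + 1)) := by
      intro v
      have := eval_dickson_add (s * w v) (s * (w v)⁻¹) (n + 1)
      rw [mul_mul_mul_comm, hss, mul_inv_cancel₀ (hw0 v), mul_one, ← mul_add] at this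
      rw [← hw v, joukowski, this, mul_pow, mul_pow, mul_add]
    have e2 : s ^ (n + 1) * (((Real.sqrt q)⁻¹ : ℝ) : ℂ) ^ (n + 1) = 1 := by
      rw [← mul_pow, Complex.ofReal_inv, mul_inv_cancel₀ hs0, one_pow]
    simp only [e]
    rw [← Finset.mul_sum, ← Finset.sum_mul, Complex.ofReal_pow]
    linear_combination (∑ v, (w v ^ (n + 1) + (w v)⁻¹ ^ (n + 1))) * cosCoeff q φ (n + 1) * e2
  · simp only [pow_zero, Finset.sum_add_distrib, Finset.sum_const, Finset.card_univ, nsmul_eq_mul]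
    ring

end RegularGraphTrace

theorem corollary1 {V : Type*} [Fintype V] (G : SimpleGraph V) [DecidableRel G.Adj]
    (q : ℕ) (hq : 1 ≤ q) (hconn : G.Connected) (hreg : G.IsRegularOfDegree (q + 1))
    (φ : ℂ → ℂ) (hφ : RegularGraphTrace.IsTestFunction q φ) :
    Integrable (fun s : ℝ =>
      (RegularGraphTrace.contractibleDensity (Fintype.card V) q s : ℂ) * φ (s : ℂ)) ∧
    (∀ γ : RegularGraphTrace.LongGeodesic G, Integrable (fun s : ℝ =>
      (RegularGraphTrace.geodesicDensity q γ s : ℂ) * φ (s : ℂ))) ∧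
    Summable (fun γ : RegularGraphTrace.LongGeodesic G =>
      RegularGraphTrace.pairing (RegularGraphTrace.geodesicDensity q γ) φ) ∧
    RegularGraphTrace.spectralDensity G φ =
      RegularGraphTrace.pairing
        (RegularGraphTrace.contractibleDensity (Fintype.card V) q) φ +
      ∑' γ : RegularGraphTrace.LongGeodesic G,
        RegularGraphTrace.pairing (RegularGraphTrace.geodesicDensity q γ) φ := by
  classical
  obtain ⟨hint, hpair⟩ := RegularGraphTrace.contractibleDensity_pairing hq hφ (Fintype.card V)
  have hloops := RegularGraphTrace.hasSum_loopCount_mul_cosCoeff (G := G) hq hreg hφ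
  -- Unconditional summability in $\mathbb C$ is absolute, which the regrouping over geodesics
  -- requires.
  have habs := hloops.summable.norm
  simp only [norm_mul (Nat.cast _ : ℂ), Complex.norm_natCast] at habs
  have hgeo := RegularGraphTrace.hasSum_longGeodesic _ habs hloops
  simp only [← (RegularGraphTrace.geodesicDensity_pairing hq hφ _).2] at hgeo
  refine ⟨hint, fun γ => (RegularGraphTrace.geodesicDensity_pairing hq hφ γ).1, hgeo.summable, ?_⟩
  rw [hgeo.tsum_eq, hpair, RegularGraphTrace.spectralDensity_eq_sum]
  ring
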